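/- Let $k\ge 1$ be an odd integer, $m\ge 1$ an integer with $\gcd(k,m)=1$, and $n=5k$. For a finite field $\mathbb{F}$ of characteristic $2$ and $h:\mathbb{F}\to\mathbb{F}$, let $$\delta_h=\max_{a,b\in\mathbb{F},\,a\neq 0}\bigl|\{x\in\mathbb{F} : h(x+a)+h(x)=b\}\bigr|$$ be the differential uniformity of $h$; $h$ is called APN if $\delta_h=2$. Let $\mathcal{L}_1,\mathcal{L}_2$ be affine permutations of $\mathbb{F}_{2^k}$ over $\mathbb{F}_2$, let $g$ be a polynomial over $\mathbb{F}_{2^k}$ that represents the function $\mathcal{L}_1\circ x^{2^m-1}\circ\mathcal{L}_2$ on $\mathbb{F}_{2^k}$, and define on $\mathbb{F}_{2^n}\supset\mathbb{F}_{2^k}$ $$f(x)=g(x)+\bigl(g(x)+x^{d}\bigr)\bigl(x+x^{2^k}\bigr)^{2^n-1},\qquad d=2^{4k}+2^{3k}+2^{2k}+2^k-1$$ (so $f=g$ on $\mathbb{F}_{2^k}$, and $f(x)=x^d$ for $x\notin\mathbb{F}_{2^k}$). (i) If $x^{2^m-1}$ is APN on $\mathbb{F}_{2^k}$, then $f$ is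 a permutation of $\mathbb{F}_{2^n}$ with $\delta_f\le 4$; if $x^{2^m-1}$ has differential uniformity exactly $4$ on $\mathbb{F}_{2^k}$, then $f$ is a permutation of $\mathbb{F}_{2^n}$ with $\delta_f=4$. (ii) If $x^{2^m-1}$ has differential uniformity exactly $6$ on $\mathbb{F}_{2^k}$, then $f$ is a permutation of $\mathbb{F}_{2^n}$ with $\delta_f=6$. -/

import Mathlib

/-- `δ_f(a,b)`: the number of `x` with `f (x + a) + f x = b` (the derivative in characteristic two). -/
def diffCount {F : Type*} [Field F] [Fintype F] [DecidableEq F] (f : F → F) (a b : F) : ℕ :=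
  (Finset.univ.filter fun x : F => f (x + a) + f x = b).card

/-- The differential uniformity `δ_f`: the maximum of `δ_f(a,b)` over all `a ≠ 0` and all `b`. -/
def differentialUniformity {F : Type*} [Field F] [Fintype F] [DecidableEq F] (f : F → F) : ℕ :=
  (Finset.univ.filter fun p : F × F => p.1 ≠ 0).sup fun p => diffCount f p.1 p.2

/-- The exponent `2^{4k} + 2^{3k} + 2^{2k} + 2^k - 1` (the subtraction never truncates). -/
def dobbertinExp (k : ℕ) : ℕ := 2 ^ (4 * k) + 2 ^ (3 * k) + 2 ^ (2 * k) + 2 ^ k - 1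

/-- The function `f(x) = g(x) + (g(x) + x^d) (x + x^{2^k})^{2^n - 1}` on `F`, with `n = 5k`,
for a polynomial `g` over the subfield `K`. -/
noncomputable def modifiedDobbertin {K F : Type*} [Field K] [Field F] [Algebra K F]
    (k : ℕ) (g : Polynomial K) (x : F) : F :=
  Polynomial.aeval x g +
    (Polynomial.aeval x g + x ^ dobbertinExp k) * (x + x ^ 2 ^ k) ^ (2 ^ (5 * k) - 1)

/-!
Off the subfield `K` the function is `x ↦ x ^ d = N(x) / x ^ 2`, where `N` is the norm of the
quintic extension `L / K`. The heart of the matter is that no four distinct elements of `L` with sum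
zero have values `N(x) / x ^ 2` with sum zero, that is, that this power map is APN.

Suppose `x₀, …, x₃` were such elements and take square roots `a i` of `N(x i)` in `K`, so that
`∑ x i = 0` and `∑ a i / x i = 0`. If three of the `x i` are linearly independent, then, as
`[L : K] = 5 < 6`, they satisfy a conic over `K`, and rationalizing it gives `x i = μ * Q i θ` for
polynomials `Q i` over `K` of degree at most two. The numerator of `∑ a i / Q i` has degree at most
six and vanishes at the five conjugates of `θ`, hence is the minimal polynomial of `θ` times a
linear form `l`. Comparing resultants with `Q i` and using that `N(Q i θ)` is a resultant,
`Res(l, Q i)` is the product of `Res(Q j, Q i)` over `j ≠ i`. Substituting these values into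
`∑ Res(l, Q i) = 0` and into the conic parametrized by the `Q i` forces the `Q i` to be dependent,
unless two of them share a root. Moving that root to infinity makes these two linear, the
numerator has degree at most five, and comparing coefficients leads to a contradiction.

For the differential uniformity, the solutions `x` of `f (x + a) + f x = b` with `a, b ∈ K` are
fixed by the Galois group, which has odd order and can move `x` only to `x` or `x + a`, so they lie
in `K`. For `a ∉ K` at most two solutions have both `x` and `x + a` off `K`, and at most one lies
in `K`, so there are at most four.
-/

open Polynomial

section Resultant

variable {R : Type*} [CommRing R]

theorem resultant_mul_left_of_natDegree_le {f₁ f₂ g : R[X]} {m₁ m₂ n : ℕ}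
    (h₁ : f₁.natDegree ≤ m₁) (h₂ : f₂.natDegree ≤ m₂) (hg : g.natDegree ≤ n) :
    resultant (f₁ * f₂) g (m₁ + m₂) n = resultant f₁ g m₁ n * resultant f₂ g m₂ n := by
  obtain ⟨k₁, rfl⟩ := le_iff_exists_add.1 h₁
  obtain ⟨k₂, rfl⟩ := le_iff_exists_add.1 h₂
  rw [add_add_add_comm, resultant_add_left_deg _ _ _ _ _ natDegree_mul_le,
    resultant_add_left_deg _ _ _ _ _ le_rfl, resultant_add_left_deg _ _ _ _ _ le_rfl,
    resultant_mul_left _ _ _ _ hg]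
  ring

theorem resultant_prod_left_of_natDegree_le {ι : Type*} (s : Finset ι) {f : ι → R[X]} {g : R[X]}
    {m : ι → ℕ} {n : ℕ} (hf : ∀ i, (f i).natDegree ≤ m i) (hg : g.natDegree ≤ n) :
    resultant (∏ i ∈ s, f i) g (∑ i ∈ s, m i) n = ∏ i ∈ s, resultant (f i) g (m i) n := by
  classical
  induction s using Finset.induction_on with
  | empty => simp
  | insert i s hi ih =>
    rw [Finset.prod_insert hi, Finset.sum_insert hi, Finset.prod_insert hi, ← ih]
    exact resultant_mul_left_of_natDegree_le (hf i)
      ((natDegree_prod_le _ _).trans (Finset.sum_le_sum fun j _ => hf j)) hg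

section Cofactor

variable {ι : Type*} [Fintype ι] [DecidableEq ι]

/-- The numerator of `∑ i, a i / Q i` over the common denominator `∏ i, Q i`. -/
noncomputable def numerator (a : ι → R) (Q : ι → R[X]) : R[X] :=
  ∑ i, C (a i) * ∏ j ∈ Finset.univ.erase i, Q j

theorem natDegree_numerator_le {a : ι → R} {Q : ι → R[X]} {d : ι → ℕ} {n : ℕ}
    (hQ : ∀ i, (Q i).natDegree ≤ d i) (hd : ∀ i, ∑ j ∈ Finset.univ.erase i, d j ≤ n) :
    (numerator a Q).natDegree ≤ n :=
  natDegree_sum_le_of_forall_le _ _ fun i _ => (natDegree_C_mul_le _ _).trans <|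
    (natDegree_prod_le _ _).trans <| (Finset.sum_le_sum fun j _ => hQ j).trans (hd i)

theorem resultant_numerator [Nontrivial ι] {a : ι → R} {Q : ι → R[X]} {d : ι → ℕ}
    (hQ : ∀ i, (Q i).natDegree ≤ d i) {i : ι} (hi : ∀ j, d i ≤ d j) :
    resultant (numerator a Q) (Q i) (∑ j ∈ Finset.univ.erase i, d j) (d i) =
      a i ^ d i * ∏ j ∈ Finset.univ.erase i, resultant (Q j) (Q i) (d j) (d i) := by
  have split : numerator a Q = C (a i) * ∏ j ∈ Finset.univ.erase i, Q j + Q i *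
      ∑ k ∈ Finset.univ.erase i, C (a k) * ∏ j ∈ (Finset.univ.erase i).erase k, Q j := by
    rw [numerator, ← Finset.add_sum_erase _ _ (Finset.mem_univ i), Finset.mul_sum]
    congr 1
    refine Finset.sum_congr rfl fun k hk => ?_
    rw [← Finset.mul_prod_erase (Finset.univ.erase k) Q
      (Finset.mem_erase.2 ⟨(Finset.ne_of_mem_erase hk).symm, Finset.mem_univ i⟩),
      Finset.erase_right_comm]
    ring
  rw [split, resultant_add_mul_left _ _ _ _ _ ?_ (hQ i), resultant_C_mul_left,
    resultant_prod_left_of_natDegree_le _ hQ (hQ i)]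
  have hsum : ∀ k ∈ Finset.univ.erase i, d k +
      ∑ j ∈ (Finset.univ.erase i).erase k, d j = ∑ j ∈ Finset.univ.erase i, d j :=
    fun k hk => Finset.add_sum_erase _ d hk
  have hdeg : (∑ k ∈ Finset.univ.erase i, C (a k) *
      ∏ j ∈ (Finset.univ.erase i).erase k, Q j).natDegree ≤
        ∑ j ∈ Finset.univ.erase i, d j - d i := by
    refine natDegree_sum_le_of_forall_le _ _ fun k hk => (natDegree_C_mul_le _ _).trans <|
      (natDegree_prod_le _ _).trans <| (Finset.sum_le_sum fun j _ => hQ j).trans ?_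
    have := hsum k hk
    have := hi k
    omega
  obtain ⟨k, hk⟩ := exists_ne i
  have := hsum k (Finset.mem_erase.2 ⟨hk, Finset.mem_univ k⟩)
  have := hi k
  omega

end Cofactor
end Resultant

section Norm

variable {K L : Type*} [Field K] [Field L] [Algebra K L]

theorem norm_aeval_gen_eq_resultant [Algebra.IsSeparable K L] (pb : PowerBasis K L) {Q : K[X]}
    {n : ℕ} (hQ : Q.natDegree ≤ n) :
    Algebra.norm K (aeval pb.gen Q) = resultant (minpoly K pb.gen) Q pb.dim n := by
  classical
  have := pb.finite
  let E := AlgebraicClosure L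
  have hP : (minpoly K pb.gen).Monic := minpoly.monic pb.isIntegral_gen
  have hsep : (minpoly K pb.gen).Separable := Algebra.IsSeparable.isSeparable K pb.gen
  have hroots : ∏ σ : L →ₐ[K] E, σ (aeval pb.gen Q) =
      (((minpoly K pb.gen).aroots E).map (eval · (Q.map (algebraMap K E)))).prod := by
    rw [Fintype.prod_equiv pb.liftEquiv' _ (fun y => (Q.map (algebraMap K E)).eval y.1)
        fun σ => by rw [pb.liftEquiv'_apply_coe, eval_map_algebraMap, aeval_algHom_apply],
      Finset.prod_mem_multiset _ _ (eval · (Q.map (algebraMap K E))) fun _ => rfl,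
      Finset.prod_eq_multiset_prod, Multiset.toFinset_val,
      Multiset.dedup_eq_self.2 (nodup_roots hsep.map)]
  apply (algebraMap K E).injective
  rw [Algebra.norm_eq_prod_embeddings K E, hroots, ← resultant_map_map, ← pb.natDegree_minpoly,
    ← (minpoly K pb.gen).natDegree_map (algebraMap K E),
    resultant_eq_prod_eval _ _ _ (natDegree_map_le.trans hQ) (IsAlgClosed.splits _),
    (hP.map _).leadingCoeff, one_pow, one_mul]

theorem exists_powerBasis_gen_eq (hp : (Module.finrank K L).Prime) {θ : L}
    (hθ : θ ∉ Set.range (algebraMap K L)) : ∃ pb : PowerBasis K L, pb.gen = θ := by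
  have : FiniteDimensional K L := Module.finite_of_finrank_pos hp.pos
  have := IntermediateField.isSimpleOrder_of_finrank_prime K L hp
  have htop : IntermediateField.adjoin K {θ} = ⊤ :=
    (eq_bot_or_eq_top _).resolve_left fun h =>
      hθ (IntermediateField.mem_bot.1 (IntermediateField.adjoin_simple_eq_bot_iff.1 h))
  have hint : IsIntegral K θ := .of_finite K θ
  refine ⟨.ofAdjoinEqTop hint ?_, PowerBasis.ofAdjoinEqTop_gen ..⟩
  rw [← IntermediateField.adjoin_simple_toSubalgebra_of_isAlgebraic hint.isAlgebraic, htop,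
    IntermediateField.top_toSubalgebra]

theorem eq_zero_of_aeval_gen_eq_zero (pb : PowerBasis K L) {p : K[X]} (hd : p.natDegree < pb.dim)
    (h : aeval pb.gen p = 0) : p = 0 := by
  by_contra hp
  exact hd.not_ge (pb.dim_le_natDegree_of_root hp h)

end Norm

section Conic

theorem exists_sq_eq {K : Type*} [Field K] [PerfectField K] [CharP K 2] (a : K) :
    ∃ b : K, b ^ 2 = a :=
  surjective_frobenius K 2 a

variable {K L : Type*} [Field K] [Field L] [Algebra K L] [PerfectField K] [CharP K 2]

theorem exists_conic {x : Fin 3 → L} (h : Module.finrank K L < 6) [FiniteDimensional K L]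
    (hx : LinearIndependent K x) :
    ∃ b A : Fin 3 → K, A ≠ 0 ∧
      (∑ i, b i • x i) ^ 2 = ∑ i, A i • ![x 1 * x 2, x 0 * x 2, x 0 * x 1] i := by
  have : CharP L 2 := charP_of_injective_algebraMap (algebraMap K L).injective 2
  obtain ⟨g, hg, hne⟩ := Fintype.not_linearIndependent_iff.1 fun hli : LinearIndependent K
      (Sum.elim (fun i => x i ^ 2) ![x 1 * x 2, x 0 * x 2, x 0 * x 1]) =>
    (hli.fintype_card_le_finrank.trans_lt h).ne rfl
  choose b hb using fun i => exists_sq_eq (g (.inl i))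
  have hconic : (∑ i, b i • x i) ^ 2 =
      ∑ i, g (.inr i) • ![x 1 * x 2, x 0 * x 2, x 0 * x 1] i := by
    rw [Fintype.sum_sum_type] at hg
    simp only [CharTwo.sum_sq, _root_.smul_pow, hb]
    exact CharTwo.add_eq_zero.1 hg
  refine ⟨b, fun i => g (.inr i), fun hA => ?_, hconic⟩
  have hA' : ∀ i, g (.inr i) = 0 := congrFun hA
  have hb0 : ∀ i, b i = 0 := Fintype.linearIndependent_iff.1 hx b <|
    pow_eq_zero_iff two_ne_zero |>.1 (by simp only [hconic, hA', zero_smul, Finset.sum_const_zero])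
  obtain ⟨i | i, hi⟩ := hne
  · exact hi (by rw [← hb, hb0, zero_pow two_ne_zero])
  · exact hi (hA' i)

theorem exists_eq_mul_aeval_gen {K L : Type*} [Field K] [Field L] [Algebra K L]
    {pb : PowerBasis K L} (h3 : 3 ≤ pb.dim) {x : Fin 3 → L} {y : L} (hy : y ≠ 0)
    {A B b₀ b₁ c : K} (h₀ : x 0 + A • x 2 = y * pb.gen ^ 2) (h₁ : x 1 + B • x 2 = y)
    (h₂ : b₀ • x 0 + b₁ • x 1 + c • x 2 = y * pb.gen) :
    ∃ Q : Fin 3 → K[X], ∀ i, (Q i).natDegree ≤ 2 ∧ x i = y * aeval pb.gen (Q i) := by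
  have hq : (X - C b₀ * X ^ 2 - C b₁).natDegree ≤ 2 := by compute_degree!
  have hrel : (c - b₀ * A - b₁ * B) • x 2 = y * aeval pb.gen (X - C b₀ * X ^ 2 - C b₁) := by
    simp only [map_sub, map_mul, aeval_C, aeval_X, map_pow, mul_sub, mul_left_comm y, ← h₀, ← h₂]
    rw [← h₁]
    simp only [Algebra.smul_def, map_sub, map_mul]
    ring
  obtain ⟨r, hr, hx₂⟩ : ∃ r : K[X], r.natDegree ≤ 2 ∧ x 2 = y * aeval pb.gen r := by
    have he : c - b₀ * A - b₁ * B ≠ 0 := fun he => by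
      rw [he, zero_smul, eq_comm, mul_eq_zero_iff_left hy] at hrel
      simpa [coeff_X, coeff_C] using congrArg (coeff · 1) <|
        eq_zero_of_aeval_gen_eq_zero pb (hq.trans_lt h3) hrel
    refine ⟨C (c - b₀ * A - b₁ * B)⁻¹ * (X - C b₀ * X ^ 2 - C b₁),
      (natDegree_C_mul_le _ _).trans hq, ?_⟩
    rw [← inv_smul_smul₀ he (x 2), hrel, map_mul, aeval_C, Algebra.smul_def, mul_left_comm]
  have hx₀ : x 0 = y * aeval pb.gen (X ^ 2 - C A * r) := by
    rw [map_sub, map_mul, aeval_C, aeval_X_pow, mul_sub, ← h₀, mul_left_comm, ← hx₂,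
      Algebra.smul_def, add_sub_cancel_right]
  have hx₁ : x 1 = y * aeval pb.gen (1 - C B * r) := by
    rw [map_sub, map_mul, aeval_C, map_one, mul_sub, mul_left_comm, ← hx₂, mul_one, ← h₁,
      Algebra.smul_def, add_sub_cancel_right]
  refine ⟨![X ^ 2 - C A * r, 1 - C B * r, r],
    Fin.forall_fin_succ.2 ⟨⟨?_, hx₀⟩, Fin.forall_fin_two.2 ⟨⟨?_, hx₁⟩, hr, hx₂⟩⟩⟩
  · exact natDegree_sub_le_of_le (natDegree_X_pow_le 2) ((natDegree_C_mul_le _ _).trans hr)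
  · exact natDegree_sub_le_of_le (natDegree_one.le.trans zero_le_two)
      ((natDegree_C_mul_le _ _).trans hr)

theorem exists_quadratic_parametrization_of_conic {x : Fin 3 → L} (hp : (Module.finrank K L).Prime)
    (h3 : 3 ≤ Module.finrank K L) (hx : LinearIndependent K x) {b : Fin 3 → K} {A B : K}
    (hconic : (∑ i, b i • x i) ^ 2 = A • (x 1 * x 2) + B • (x 0 * x 2) + x 0 * x 1) :
    ∃ (μ : L) (pb : PowerBasis K L) (Q : Fin 3 → K[X]), μ ≠ 0 ∧
      ∀ i, (Q i).natDegree ≤ 2 ∧ x i = μ * aeval pb.gen (Q i) := by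
  have : CharP L 2 := charP_of_injective_algebraMap (algebraMap K L).injective 2
  have hlin := Fintype.linearIndependent_iff.1 hx
  simp only [Fin.sum_univ_three] at hlin hconic
  obtain ⟨c, hc⟩ := exists_sq_eq (A * B)
  have hsq : (b 0 • x 0 + b 1 • x 1 + (b 2 + c) • x 2) ^ 2 = (x 0 + A • x 2) * (x 1 + B • x 2) := by
    rw [add_smul, ← add_assoc, CharTwo.add_sq, hconic, _root_.smul_pow, hc]
    simp only [Algebra.smul_def, map_mul]
    ring
  have hy : x 1 + B • x 2 ≠ 0 := fun h0 => by simpa using hlin ![0, 1, B] (by simpa using h0) 1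
  obtain ⟨θ, h₂⟩ : ∃ θ, b 0 • x 0 + b 1 • x 1 + (b 2 + c) • x 2 = (x 1 + B • x 2) * θ :=
    ⟨_, (mul_div_cancel₀ _ hy).symm⟩
  have h₀ : x 0 + A • x 2 = (x 1 + B • x 2) * θ ^ 2 :=
    mul_right_cancel₀ hy (by rw [← hsq, h₂]; ring)
  have hθ : θ ∉ Set.range (algebraMap K L) := by
    rintro ⟨k, rfl⟩
    simpa using hlin ![1, -k ^ 2, A - k ^ 2 * B] (by
      simp only [Algebra.smul_def, Matrix.cons_val, map_one, map_neg, map_sub, map_mul,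
        map_pow] at h₀ ⊢
      linear_combination h₀) 0
  obtain ⟨pb, rfl⟩ := exists_powerBasis_gen_eq hp hθ
  obtain ⟨Q, hQ⟩ := exists_eq_mul_aeval_gen (pb.finrank ▸ h3) hy h₀ rfl h₂
  exact ⟨_, pb, Q, hy, hQ⟩

theorem exists_quadratic_parametrization (h5 : Module.finrank K L = 5) {x : Fin 3 → L}
    (hx : LinearIndependent K x) :
    ∃ (μ : L) (pb : PowerBasis K L) (Q : Fin 3 → K[X]), μ ≠ 0 ∧
      ∀ i, (Q i).natDegree ≤ 2 ∧ x i = μ * aeval pb.gen (Q i) := by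
  have : FiniteDimensional K L := Module.finite_of_finrank_pos (by omega)
  obtain ⟨b, A, hA, hconic⟩ := exists_conic (by omega) hx
  obtain ⟨i, hi⟩ := Function.ne_iff.1 hA
  obtain ⟨s, hs⟩ := exists_sq_eq (A i)⁻¹
  let σ := Equiv.swap i 2
  have hscaled : (∑ j, (s * b (σ j)) • x (σ j)) ^ 2 = (A (σ 0) / A i) • (x (σ 1) * x (σ 2)) +
      (A (σ 1) / A i) • (x (σ 0) * x (σ 2)) + x (σ 0) * x (σ 1) := by
    simp only [mul_smul, ← Finset.smul_sum, _root_.smul_pow, hs,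
      Equiv.sum_comp σ fun j => b j • x j, hconic]
    rw [inv_smul_eq_iff₀ hi, Fin.sum_univ_three, smul_add, smul_add, smul_smul, smul_smul,
      mul_div_cancel₀ _ hi, mul_div_cancel₀ _ hi]
    simp only [σ]
    fin_cases i <;> simp [Equiv.swap_apply_def, Algebra.smul_def] <;> ring
  obtain ⟨μ, pb, Q, hμ, hQ⟩ := exists_quadratic_parametrization_of_conic (x := x ∘ σ)
    (by rw [h5]; norm_num) (by omega) (hx.comp σ σ.injective) hscaled
  exact ⟨μ, pb, Q ∘ σ.symm, hμ, fun j => by simpa using hQ (σ.symm j)⟩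

end Conic

section Quadratic

theorem resultant_two_two {R : Type*} [CommRing R] (p q : R[X]) :
    resultant p q 2 2 = (p.coeff 2 * q.coeff 0 - p.coeff 0 * q.coeff 2) ^ 2 -
      (p.coeff 2 * q.coeff 1 - p.coeff 1 * q.coeff 2) *
        (p.coeff 1 * q.coeff 0 - p.coeff 0 * q.coeff 1) := by
  simp [resultant, sylvester, Matrix.det_succ_row_zero, Fin.sum_univ_succ, Fin.addCases,
    Fin.succAbove]
  ring

theorem resultant_one_two {R : Type*} [CommRing R] (l q : R[X]) :
    resultant l q 1 2 = q.coeff 2 * l.coeff 0 ^ 2 - q.coeff 1 * l.coeff 0 * l.coeff 1 +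
      q.coeff 0 * l.coeff 1 ^ 2 := by
  simp [resultant, sylvester, Matrix.det_succ_row_zero, Fin.sum_univ_succ, Fin.addCases,
    Fin.succAbove]
  ring

variable {R : Type*} [CommRing R]

/-- The determinant of the coefficients of three polynomials of degree at most two. Over a field it
vanishes exactly when they are linearly dependent. -/
noncomputable def coeffDet (p q r : R[X]) : R :=
  (Matrix.of fun i j : Fin 3 => (![p, q, r] i).coeff j).det

theorem coeffDet_eq (p q r : R[X]) :
    coeffDet p q r = p.coeff 0 * (q.coeff 1 * r.coeff 2 - q.coeff 2 * r.coeff 1) -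
      p.coeff 1 * (q.coeff 0 * r.coeff 2 - q.coeff 2 * r.coeff 0) +
      p.coeff 2 * (q.coeff 0 * r.coeff 1 - q.coeff 1 * r.coeff 0) := by
  rw [coeffDet, Matrix.det_fin_three]
  simp only [Matrix.of_apply, Matrix.cons_val, Fin.val_zero, Fin.val_one, Fin.val_two]
  ring

theorem coeffDet_rotate (p q r : R[X]) : coeffDet q r p = coeffDet p q r := by
  rw [coeffDet_eq, coeffDet_eq]
  ring

theorem resultant_two_two_comm (p q : R[X]) : resultant p q 2 2 = resultant q p 2 2 := by
  rw [resultant_comm, (by decide : Even (2 * 2)).neg_one_pow, one_mul]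

variable [CharP R 2]

theorem resultant_add_add (p q r : R[X]) :
    resultant p (p + q + r) 2 2 =
      resultant p q 2 2 + resultant p r 2 2 + coeffDet p q r * p.coeff 1 := by
  simp only [resultant_two_two, coeffDet_eq, coeff_add]
  grind

theorem coeffDet_sq (p q r : R[X]) :
    coeffDet p q r ^ 2 = resultant p q 2 2 * r.coeff 1 ^ 2 + resultant p r 2 2 * q.coeff 1 ^ 2 +
      resultant q r 2 2 * p.coeff 1 ^ 2 + coeffDet p q r * p.coeff 1 * q.coeff 1 * r.coeff 1 := by
  simp only [resultant_two_two, coeffDet_eq]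
  grind

theorem conic_identity (p q r l : R[X]) {x y z : R} (hx : x = resultant l p 1 2)
    (hy : y = resultant l q 1 2) (hz : z = resultant l r 1 2) :
    resultant q r 2 2 * x ^ 2 + resultant p r 2 2 * y ^ 2 + resultant p q 2 2 * z ^ 2 +
      coeffDet p q r * (r.coeff 1 * x * y + q.coeff 1 * x * z + p.coeff 1 * y * z) = 0 := by
  simp only [hx, hy, hz, resultant_two_two, resultant_one_two, coeffDet_eq]
  grind

-- `A`, `B`, `C`, `r₀`, `r₁`, `r₂` stand for the resultants of the six pairs among four
-- quadratics with sum zero, and `hconic` is the equation of the conic they parametrize.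
theorem discriminant_eq_zero_of_residual [IsDomain R] {A B C b₀ b₁ b₂ r₀ r₁ r₂ : R} (hA : A ≠ 0)
    (hB : B ≠ 0) (hC : C ≠ 0) (hr₀ : r₀ ≠ 0) (hr₁ : r₁ ≠ 0) (hr₂ : r₂ ≠ 0) (h₀ : r₀ = A + B + b₀)
    (h₁ : r₁ = A + C + b₁) (h₂ : r₂ = B + C + b₂)
    (hsum : A * B * r₀ + A * C * r₁ + B * C * r₂ + r₀ * r₁ * r₂ = 0)
    (hconic : C * (A * B * r₀) ^ 2 + B * (A * C * r₁) ^ 2 + A * (B * C * r₂) ^ 2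
      + (b₂ * (A * B * r₀) * (A * C * r₁) + b₁ * (A * B * r₀) * (B * C * r₂)
      + b₀ * (A * C * r₁) * (B * C * r₂)) = 0) :
    A * b₂ ^ 2 + B * b₁ ^ 2 + C * b₀ ^ 2 + b₀ * b₁ * b₂ = 0 := by
  obtain rfl : b₀ = A + B + r₀ := by grind
  obtain rfl : b₁ = A + C + r₁ := by grind
  obtain rfl : b₂ = B + C + r₂ := by grind
  clear h₀ h₁ h₂
  have reduce : ∀ x y z t : R, x + y + z + t = 0 →
      C * x ^ 2 + B * y ^ 2 + A * z ^ 2 + ((B + C + r₂) * x * y + (A + C + r₁) * x * z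
        + (A + B + r₀) * y * z) =
      A * z * t + B * y * t + C * x * t + r₀ * y * z + r₁ * x * z + r₂ * x * y := by
    intro x y z t h
    obtain rfl : t = x + y + z := by grind
    clear * -
    grind
  have hprod : A * B * C * r₀ * r₁ * r₂ * (A + B + C + r₀ + r₁ + r₂) = 0 := by
    rw [← hconic, reduce _ _ _ _ hsum]
    ring
  have hs : A + B + C + r₀ + r₁ + r₂ = 0 := by simpa [hA, hB, hC, hr₀, hr₁, hr₂] using hprod
  rw [← hsum]
  clear * - hs
  grind

theorem coeffDet_eq_zero_of_residual [IsDomain R] {p q r l : R[X]}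
    (hpq : resultant p q 2 2 ≠ 0) (hpr : resultant p r 2 2 ≠ 0) (hqr : resultant q r 2 2 ≠ 0)
    (hps : resultant p (p + q + r) 2 2 ≠ 0) (hqs : resultant q (p + q + r) 2 2 ≠ 0)
    (hrs : resultant r (p + q + r) 2 2 ≠ 0)
    (hp : resultant l p 1 2 =
      resultant p q 2 2 * resultant p r 2 2 * resultant p (p + q + r) 2 2)
    (hq : resultant l q 1 2 =
      resultant p q 2 2 * resultant q r 2 2 * resultant q (p + q + r) 2 2)
    (hr : resultant l r 1 2 =
      resultant p r 2 2 * resultant q r 2 2 * resultant r (p + q + r) 2 2)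
    (hs : resultant l (p + q + r) 1 2 = resultant p (p + q + r) 2 2 *
      resultant q (p + q + r) 2 2 * resultant r (p + q + r) 2 2) :
    coeffDet p q r = 0 := by
  have hsum : resultant l p 1 2 + resultant l q 1 2 + resultant l r 1 2 +
      resultant l (p + q + r) 1 2 = 0 := by
    simp only [resultant_one_two, coeff_add]
    grind
  have hdisc := discriminant_eq_zero_of_residual (b₀ := coeffDet p q r * p.coeff 1)
    (b₁ := coeffDet p q r * q.coeff 1) (b₂ := coeffDet p q r * r.coeff 1) hpq hpr hqr hps hqs hrs
    (resultant_add_add p q r)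
    (by rw [show p + q + r = q + r + p by ring, resultant_add_add, coeffDet_rotate,
      resultant_two_two_comm q p, add_comm (resultant q r 2 2)])
    (by rw [show p + q + r = r + p + q by ring, resultant_add_add, ← coeffDet_rotate,
      resultant_two_two_comm r p, resultant_two_two_comm r q])
    (by rw [← hp, ← hq, ← hr, ← hs, hsum])
    (by rw [← hp, ← hq, ← hr, ← conic_identity p q r l rfl rfl rfl]; ring)
  rw [← pow_eq_zero_iff four_ne_zero, ← hdisc, show (4 : ℕ) = 2 + 2 from rfl, pow_add]
  nth_rw 2 [coeffDet_sq]
  ring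

end Quadratic

section Family

/-- The map `x ↦ N(x) / x ^ 2`, which sends `0` to `0`. If `K` has `q` elements and `L` has degree
five over `K`, it is the power map with exponent `q ^ 4 + q ^ 3 + q ^ 2 + q - 1`. -/
noncomputable def normDivSq (K : Type*) {L : Type*} [Field K] [Field L] [Algebra K L] (x : L) : L :=
  algebraMap K L (Algebra.norm K x) / x ^ 2

theorem normDivSq_zero (K L : Type*) [Field K] [Field L] [Algebra K L] :
    normDivSq K (0 : L) = 0 := by
  rw [normDivSq, zero_pow two_ne_zero, div_zero]

theorem normDivSq_mul {K L : Type*} [Field K] [Field L] [Algebra K L] (x y : L) :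
    normDivSq K (x * y) = normDivSq K x * normDivSq K y := by
  rw [normDivSq, map_mul, map_mul, mul_pow, mul_div_mul_comm, normDivSq, normDivSq]

theorem normDivSq_ne_zero {K L : Type*} [Field K] [Field L] [Algebra K L] [FiniteDimensional K L]
    {x : L} (hx : x ≠ 0) : normDivSq K x ≠ 0 :=
  div_ne_zero ((_root_.map_ne_zero _).2 (Algebra.norm_ne_zero_iff.2 hx)) (pow_ne_zero 2 hx)

theorem normDivSq_algebraMap {K L : Type*} [Field K] [Field L] [Algebra K L]
    (h5 : Module.finrank K L = 5) (c : K) :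
    normDivSq K (algebraMap K L c) = algebraMap K L (c ^ 3) := by
  rcases eq_or_ne c 0 with rfl | hc
  · rw [map_zero, normDivSq_zero, zero_pow three_ne_zero, map_zero]
  · rw [normDivSq, Algebra.norm_algebraMap, h5, ← map_pow, ← map_div₀,
      (div_eq_iff (pow_ne_zero 2 hc)).2 (pow_add c 3 2)]

/-- A family of distinct nonzero elements of `L` with sum zero on which `normDivSq` has sum zero.
The map `normDivSq K` is APN if there is no such family of three or four elements. -/
structure IsVanishingFamily (K : Type*) {L ι : Type*} [Field K] [Field L] [Algebra K L]
    [Fintype ι] (x : ι → L) : Prop where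
  injective : Function.Injective x
  ne_zero : ∀ i, x i ≠ 0
  sum_eq_zero : ∑ i, x i = 0
  sum_normDivSq_eq_zero : ∑ i, normDivSq K (x i) = 0

namespace IsVanishingFamily

variable {K L ι : Type*} [Field K] [Field L] [Algebra K L] [Fintype ι] {x : ι → L}

theorem comp (h : IsVanishingFamily K x) {κ : Type*} [Fintype κ] (σ : κ ≃ ι) :
    IsVanishingFamily K (x ∘ σ) where
  injective := h.injective.comp σ.injective
  ne_zero i := h.ne_zero (σ i)
  sum_eq_zero := (σ.sum_comp x).trans h.sum_eq_zero
  sum_normDivSq_eq_zero :=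
    (σ.sum_comp fun i => normDivSq K (x i)).trans h.sum_normDivSq_eq_zero

theorem of_eq_mul [FiniteDimensional K L] (h : IsVanishingFamily K x) {y : L} (hy : y ≠ 0)
    {z : ι → L} (hz : ∀ i, x i = y * z i) : IsVanishingFamily K z where
  injective i j hij := h.injective (by rw [hz, hz, hij])
  ne_zero i hi := h.ne_zero i (by rw [hz, hi, mul_zero])
  sum_eq_zero := by
    have := h.sum_eq_zero
    simp only [hz, ← Finset.mul_sum] at this
    exact (mul_eq_zero_iff_left hy).1 this
  sum_normDivSq_eq_zero := by
    have := h.sum_normDivSq_eq_zero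
    simp only [hz, normDivSq_mul, ← Finset.mul_sum] at this
    exact (mul_eq_zero_iff_left (normDivSq_ne_zero hy)).1 this

theorem sum_cube_eq_zero [FiniteDimensional K L] (h5 : Module.finrank K L = 5)
    (h : IsVanishingFamily K x) {y : L} {c : ι → K} (hc : ∀ i, x i = c i • y) :
    ∑ i, c i ^ 3 = 0 := by
  rcases isEmpty_or_nonempty ι with _ | ⟨⟨i⟩⟩
  · simp
  have hy : y ≠ 0 := fun hy => h.ne_zero i (by rw [hc, hy, smul_zero])
  have hz := h.of_eq_mul hy (z := fun i => algebraMap K L (c i)) fun i => by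
    rw [hc, Algebra.smul_def, mul_comm]
  apply (algebraMap K L).injective
  rw [map_zero, ← hz.sum_normDivSq_eq_zero, map_sum]
  exact Finset.sum_congr rfl fun i _ => (normDivSq_algebraMap h5 (c i)).symm

theorem exists_sqrt_norm [FiniteDimensional K L] [PerfectField K] [CharP K 2]
    (h : IsVanishingFamily K x) :
    ∃ a : ι → K, (∀ i, a i ≠ 0 ∧ a i ^ 2 = Algebra.norm K (x i)) ∧
      ∑ i, algebraMap K L (a i) / x i = 0 := by
  have : CharP L 2 := charP_of_injective_algebraMap (algebraMap K L).injective 2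
  choose a ha using fun i => exists_sq_eq (Algebra.norm K (x i))
  refine ⟨a, fun i => ⟨fun h0 => h.ne_zero i ?_, ha i⟩, ?_⟩
  · rw [← Algebra.norm_eq_zero_iff (R := K), ← ha, h0, zero_pow two_ne_zero]
  · rw [← pow_eq_zero_iff two_ne_zero, CharTwo.sum_sq]
    simpa only [div_pow, ← map_pow, ha, normDivSq] using h.sum_normDivSq_eq_zero

end IsVanishingFamily

theorem aeval_numerator {K L ι : Type*} [Field K] [Field L] [Algebra K L] [Fintype ι]
    [DecidableEq ι] (a : ι → K) {Q : ι → K[X]} {t : L} (hQ : ∀ i, aeval t (Q i) ≠ 0) :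
    aeval t (numerator a Q) =
      (∏ i, aeval t (Q i)) * ∑ i, algebraMap K L (a i) / aeval t (Q i) := by
  simp only [numerator, map_sum, map_mul, map_prod, aeval_C, Finset.mul_sum]
  refine Finset.sum_congr rfl fun i _ => ?_
  rw [← Finset.mul_prod_erase _ _ (Finset.mem_univ i), mul_div_assoc', mul_comm,
    mul_comm (aeval t (Q i)), mul_right_comm, mul_div_cancel_right₀ _ (hQ i)]

end Family

section Residual

variable {K L ι : Type*} [Field K] [Field L] [Algebra K L] [Fintype ι] [DecidableEq ι]
  {a : ι → K} {Q : ι → K[X]}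

theorem numerator_eq_zero_of_natDegree_lt {pb : PowerBasis K L} {n : ℕ}
    (hQ : ∀ i, (Q i).natDegree ≤ n) (hn : (Fintype.card ι - 1) * n < pb.dim)
    (h : aeval pb.gen (numerator a Q) = 0) : numerator a Q = 0 := by
  refine eq_zero_of_aeval_gen_eq_zero pb ((natDegree_numerator_le hQ fun i => ?_).trans_lt hn) h
  simp [Finset.card_erase_of_mem]

theorem exists_numerator_eq_minpoly_mul (pb : PowerBasis K L) {e : ℕ}
    (hd : (numerator a Q).natDegree ≤ pb.dim + e) (h : aeval pb.gen (numerator a Q) = 0) :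
    ∃ l : K[X], l.natDegree ≤ e ∧ numerator a Q = minpoly K pb.gen * l := by
  obtain ⟨l, hl⟩ := minpoly.dvd K pb.gen h
  refine ⟨l, ?_, hl⟩
  rcases eq_or_ne l 0 with rfl | h0
  · simp
  · have := pb.finite
    rw [hl, (minpoly.monic pb.isIntegral_gen).natDegree_mul' h0, pb.natDegree_minpoly] at hd
    omega

theorem norm_mul_resultant_cofactor [Algebra.IsSeparable K L] [Nontrivial ι] {pb : PowerBasis K L}
    {d : ι → ℕ} {l : K[X]} {e : ℕ} (hQ : ∀ i, (Q i).natDegree ≤ d i) (hl : l.natDegree ≤ e)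
    (hS : numerator a Q = minpoly K pb.gen * l) {i : ι} (hi : ∀ j, d i ≤ d j)
    (hd : ∑ j ∈ Finset.univ.erase i, d j = pb.dim + e) :
    Algebra.norm K (aeval pb.gen (Q i)) * resultant l (Q i) e (d i) =
      a i ^ d i * ∏ j ∈ Finset.univ.erase i, resultant (Q j) (Q i) (d j) (d i) := by
  have := pb.finite
  rw [norm_aeval_gen_eq_resultant pb (hQ i), ← resultant_mul_left_of_natDegree_le
    (pb.natDegree_minpoly).le hl (hQ i), ← hS, ← hd, resultant_numerator hQ hi]

end Residual

section Rank

theorem resultant_one_one {R : Type*} [CommRing R] (p q : R[X]) :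
    resultant p q 1 1 = p.coeff 1 * q.coeff 0 - p.coeff 0 * q.coeff 1 := by
  simp [resultant, sylvester, Matrix.det_fin_two, Fin.addCases]
  ring

theorem exists_eq_C_mul_of_resultant_eq_zero {K : Type*} [Field K] {p q : K[X]}
    (hp : p.natDegree ≤ 1) (hq : q.natDegree ≤ 1) (hq0 : q ≠ 0) (h : resultant p q 1 1 = 0) :
    ∃ c : K, p = C c * q := by
  rw [resultant_one_one] at h
  rw [eq_X_add_C_of_natDegree_le_one hp, eq_X_add_C_of_natDegree_le_one hq]
  by_cases h1 : q.coeff 1 = 0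
  · have h0 : q.coeff 0 ≠ 0 := fun h0 => hq0 <| by
      rw [eq_X_add_C_of_natDegree_le_one hq, h0, h1]; simp
    refine ⟨p.coeff 0 / q.coeff 0, ?_⟩
    have : p.coeff 1 = 0 := by simpa [h1, h0] using h
    simp [h1, this, ← C_mul, div_mul_cancel₀ _ h0]
  · refine ⟨p.coeff 1 / q.coeff 1, ?_⟩
    rw [mul_add, ← mul_assoc, ← C_mul, ← C_mul, div_mul_cancel₀ _ h1, div_mul_eq_mul_div,
      sub_eq_zero.1 h, mul_div_cancel_right₀ _ h1]

variable {K L ι : Type*} [Field K] [Field L] [Algebra K L]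

theorem exists_linear_parametrization (hp : (Module.finrank K L).Prime) {x : ι → L}
    (h : (Set.range x).finrank K = 2) :
    ∃ (y : L) (pb : PowerBasis K L) (Q : ι → K[X]), y ≠ 0 ∧
      ∀ i, (Q i).natDegree ≤ 1 ∧ x i = y * aeval pb.gen (Q i) := by
  have : FiniteDimensional K L := Module.finite_of_finrank_pos hp.pos
  let b := Module.finBasisOfFinrankEq K _ h
  have hb : LinearIndependent K fun i => (b i : L) :=
    b.linearIndependent.map' (Submodule.subtype _) (Submodule.ker_subtype _)
  have hb0 : (b 0 : L) ≠ 0 := hb.ne_zero 0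
  have hθ : (b 1 : L) / b 0 ∉ Set.range (algebraMap K L) := by
    rintro ⟨k, hk⟩
    simpa using Fintype.linearIndependent_iff.1 hb ![-k, 1] (by
      rw [eq_div_iff hb0] at hk
      simp [Algebra.smul_def, hk]) 1
  obtain ⟨pb, hpb⟩ := exists_powerBasis_gen_eq hp hθ
  choose c hc using fun i =>
    (b.mem_submodule_iff' (x := x i)).1 (Submodule.subset_span (Set.mem_range_self i))
  refine ⟨b 0, pb, fun i => C (c i 1) * X + C (c i 0), hb0, fun i => ⟨natDegree_linear_le, ?_⟩⟩
  rw [hc i, Fin.sum_univ_two, map_add, map_mul, aeval_C, aeval_C, aeval_X, hpb, mul_add,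
    mul_left_comm, mul_div_cancel₀ _ hb0, Algebra.smul_def, Algebra.smul_def, add_comm,
    mul_comm (b 0 : L)]

theorem IsVanishingFamily.exists_eq_smul_of_linear [Fintype ι] [Nontrivial ι] [PerfectField K]
    [CharP K 2] {pb : PowerBasis K L} {Q : ι → K[X]} (hQ : ∀ i, (Q i).natDegree ≤ 1)
    (hι : Fintype.card ι ≤ pb.dim) (h : IsVanishingFamily K fun i => aeval pb.gen (Q i)) (i : ι) :
    ∃ j ≠ i, ∃ c : K, aeval pb.gen (Q j) = c • aeval pb.gen (Q i) := by
  classical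
  have := pb.finite
  obtain ⟨a, ha, hsum⟩ := h.exists_sqrt_norm
  have hnum : numerator a Q = 0 := numerator_eq_zero_of_natDegree_lt (pb := pb) (n := 1) hQ
    (by have := Fintype.card_pos (α := ι); omega)
    (by rw [aeval_numerator a h.ne_zero, hsum, mul_zero])
  have hprod := resultant_numerator (a := a) (d := fun _ => 1) hQ (i := i) fun _ => le_rfl
  rw [hnum, resultant_zero_left, zero_pow one_ne_zero, zero_mul, pow_one, eq_comm, mul_eq_zero,
    or_iff_right (ha i).1, Finset.prod_eq_zero_iff] at hprod
  obtain ⟨j, hj, hij⟩ := hprod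
  obtain ⟨c, hc⟩ := exists_eq_C_mul_of_resultant_eq_zero (hQ j) (hQ i)
    (fun h0 => h.ne_zero i (by rw [h0, map_zero])) hij
  exact ⟨j, Finset.ne_of_mem_erase hj, c, by rw [hc, map_mul, aeval_C, Algebra.smul_def]⟩

end Rank

section Span

namespace IsVanishingFamily

variable {K L ι : Type*} [Field K] [Field L] [Algebra K L]

theorem exists_eq_smul_of_finrank_le_two [Fintype ι] [Nontrivial ι] [PerfectField K] [CharP K 2]
    {x : ι → L} (h : IsVanishingFamily K x) (hp : (Module.finrank K L).Prime)
    (hι : Fintype.card ι ≤ Module.finrank K L) (hx : (Set.range x).finrank K ≤ 2) (i : ι) :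
    ∃ j ≠ i, ∃ c : K, x j = c • x i := by
  have : FiniteDimensional K L := Module.finite_of_finrank_pos hp.pos
  rcases hx.lt_or_eq with h1 | h2
  · obtain ⟨v, hv⟩ := finrank_le_one_iff.1 (Nat.le_of_lt_succ h1)
    choose c hc using fun j => hv ⟨x j, Submodule.subset_span (Set.mem_range_self j)⟩
    have hcx (j) : c j • (v : L) = x j := congrArg Subtype.val (hc j)
    have hci : c i ≠ 0 := fun h0 => h.ne_zero i (by rw [← hcx, h0, zero_smul])
    obtain ⟨j, hj⟩ := exists_ne i
    exact ⟨j, hj, c j / c i, by rw [← hcx, ← hcx, smul_smul, div_mul_cancel₀ _ hci]⟩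
  · obtain ⟨y, pb, Q, hy, hQ⟩ := exists_linear_parametrization hp h2
    obtain ⟨j, hj, c, hc⟩ := (h.of_eq_mul hy fun i => (hQ i).2).exists_eq_smul_of_linear
      (fun i => (hQ i).1) (pb.finrank ▸ hι) i
    exact ⟨j, hj, c, by rw [(hQ j).2, (hQ i).2, hc, mul_smul_comm]⟩

theorem exists_coeff_of_mem_span_singleton [Fintype ι] [FiniteDimensional K L]
    (h5 : Module.finrank K L = 5) {x : ι → L} (h : IsVanishingFamily K x) {y : L}
    (hx : ∀ i, x i ∈ Submodule.span K {y}) :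
    ∃ c : ι → K, Function.Injective c ∧ (∀ i, c i ≠ 0) ∧ ∑ i, c i = 0 ∧ ∑ i, c i ^ 3 = 0 := by
  choose c hc using fun i => Submodule.mem_span_singleton.1 (hx i)
  have hci (i) : c i ≠ 0 := fun h0 => h.ne_zero i (by rw [← hc, h0, zero_smul])
  refine ⟨c, fun i j hij => h.injective ?_, hci, ?_, h.sum_cube_eq_zero h5 fun i => (hc i).symm⟩
  · rw [← hc, ← hc, hij]
  · rcases isEmpty_or_nonempty ι with _ | ⟨⟨i⟩⟩
    · simp
    · refine (smul_eq_zero_iff_left fun hy => h.ne_zero i ?_).1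
        (by simpa only [Finset.sum_smul, hc] using h.sum_eq_zero : (∑ i, c i) • y = 0)
      rw [← hc, hy, smul_zero]

theorem finrank_range_lt_card [Fintype ι] [Nonempty ι] {x : ι → L} (h : IsVanishingFamily K x) :
    (Set.range x).finrank K < Fintype.card ι := by
  refine lt_of_not_ge fun hle => ?_
  simpa using Fintype.linearIndependent_iff.1 (linearIndependent_iff_card_le_finrank_span.2 hle)
    (fun _ => 1) (by simpa using h.sum_eq_zero) (Classical.arbitrary ι)

theorem not_fin_three [PerfectField K] [CharP K 2] (h5 : Module.finrank K L = 5) (x : Fin 3 → L) :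
    ¬ IsVanishingFamily K x := by
  intro h
  have : CharP L 2 := charP_of_injective_algebraMap (algebraMap K L).injective 2
  have : FiniteDimensional K L := Module.finite_of_finrank_pos (h5 ▸ Nat.succ_pos 4)
  have hsum := h.sum_eq_zero
  rw [Fin.sum_univ_three] at hsum
  have hx2 : x 2 = x 0 + x 1 := (CharTwo.add_eq_zero.1 hsum).symm
  obtain ⟨j, hj, hmem⟩ : ∃ j ≠ 0, x j ∈ Submodule.span K {x 0} := by
    obtain ⟨j, hj, c, hc⟩ := h.exists_eq_smul_of_finrank_le_two (by norm_num [h5]) (by simp [h5])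
      (Nat.le_of_lt_succ (by simpa using h.finrank_range_lt_card)) 0
    exact ⟨j, hj, Submodule.mem_span_singleton.2 ⟨c, hc.symm⟩⟩
  have h0 := Submodule.mem_span_singleton_self (R := K) (x 0)
  obtain ⟨c, -, hc, hsum1, hsum3⟩ := h.exists_coeff_of_mem_span_singleton h5 (y := x 0) (by
    rw [Fin.forall_fin_succ, Fin.forall_fin_two]
    refine ⟨h0, ?_⟩
    have h12 : x 1 ∈ Submodule.span K {x 0} ↔ x 2 ∈ Submodule.span K {x 0} := by
      rw [hx2, Submodule.add_mem_iff_right _ h0]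
    fin_cases j
    · exact absurd rfl hj
    · exact ⟨hmem, h12.1 hmem⟩
    · exact ⟨h12.2 hmem, hmem⟩)
  rw [Fin.sum_univ_three] at hsum1 hsum3
  have : c 0 * c 1 * c 2 = 0 := by grind
  simp [hc] at this

theorem mem_span_singleton_of_forall_eq_smul [CharP K 2] {x : Fin 4 → L} (h : IsVanishingFamily K x)
    (hx : ∀ i, ∃ j ≠ i, ∃ c : K, x j = c • x i) (i : Fin 4) : x i ∈ Submodule.span K {x 0} := by
  have : CharP L 2 := charP_of_injective_algebraMap (algebraMap K L).injective 2
  have h0 := Submodule.mem_span_singleton_self (R := K) (x 0)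
  obtain ⟨j, hj0, c, hc⟩ := hx 0
  have hj : x j ∈ Submodule.span K {x 0} := Submodule.mem_span_singleton.2 ⟨c, hc.symm⟩
  obtain ⟨m, hmi, d, hd⟩ := hx i
  have hd0 : d ≠ 0 := fun hd0 => h.ne_zero m (by rw [hd, hd0, zero_smul])
  have of_mem (hm : x m ∈ Submodule.span K {x 0}) : x i ∈ Submodule.span K {x 0} := by
    rwa [hd, Submodule.smul_mem_iff _ hd0] at hm
  rcases eq_or_ne i 0 with rfl | hi0
  · exact h0
  rcases eq_or_ne i j with rfl | hij
  · exact hj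
  rcases eq_or_ne m 0 with rfl | hm0
  · exact of_mem h0
  rcases eq_or_ne m j with rfl | hmj
  · exact of_mem hj
  have huniv : ({0, j, i, m} : Finset (Fin 4)) = Finset.univ := by
    clear * - hj0 hmi hi0 hij hm0 hmj
    revert i j m
    decide
  have hd1 : d + 1 ≠ 0 := fun h1 => hmi (h.injective (by
    rw [hd, CharTwo.add_eq_zero.1 h1, one_smul]))
  have hsum : (d + 1) • x i = x 0 + x j := by
    have hsum := h.sum_eq_zero
    rw [← huniv, Finset.sum_insert (by simp [hj0.symm, hi0.symm, hm0.symm]),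
      Finset.sum_insert (by simp [hij.symm, hmj.symm]), Finset.sum_pair hmi.symm] at hsum
    rw [add_smul, one_smul, ← hd]
    grind
  exact (Submodule.smul_mem_iff _ hd1).1 (hsum ▸ add_mem h0 hj)

theorem linearIndependent_comp_castSucc [PerfectField K] [CharP K 2] (h5 : Module.finrank K L = 5)
    {x : Fin 4 → L} (h : IsVanishingFamily K x) : LinearIndependent K (x ∘ Fin.castSucc) := by
  have : FiniteDimensional K L := Module.finite_of_finrank_pos (h5 ▸ Nat.succ_pos 4)
  have hspan : Submodule.span K (Set.range x) ≤
      Submodule.span K (Set.range (x ∘ Fin.castSucc)) := by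
    refine Submodule.span_le.2 (Set.range_subset_iff.2 (Fin.lastCases ?_ fun i => ?_))
    · have hsum := h.sum_eq_zero
      rw [Fin.sum_univ_castSucc] at hsum
      rw [eq_neg_of_add_eq_zero_right hsum]
      exact neg_mem (sum_mem fun i _ => Submodule.subset_span ⟨i, rfl⟩)
    · exact Submodule.subset_span ⟨i, rfl⟩
  rw [linearIndependent_iff_card_le_finrank_span, Fintype.card_fin]
  refine le_trans (Nat.succ_le_of_lt (lt_of_not_ge fun hx => ?_)) (Submodule.finrank_mono hspan)
  obtain ⟨c, hinj, -, hsum1, hsum3⟩ := h.exists_coeff_of_mem_span_singleton h5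
    (h.mem_span_singleton_of_forall_eq_smul
      (h.exists_eq_smul_of_finrank_le_two (by norm_num [h5]) (by simp [h5]) hx))
  rw [Fin.sum_univ_four] at hsum1 hsum3
  have hprod : (c 0 + c 1) * (c 0 + c 2) * (c 1 + c 2) = 0 := by grind
  simp [CharTwo.add_eq_zero, hinj.eq_iff] at hprod

end IsVanishingFamily
end Span

section Paired

theorem IsVanishingFamily.not_paired {K L : Type*} [Field K] [Field L] [Algebra K L] [CharP K 2]
    (h5 : Module.finrank K L = 5) {x : Fin 4 → L} (h : IsVanishingFamily K x) {a : Fin 4 → K}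
    (ha : ∀ i, a i ≠ 0 ∧ a i ^ 2 = Algebra.norm K (x i))
    (hsum : ∑ i, algebraMap K L (a i) / x i = 0) : ¬ (a 0 = a 1 ∧ a 2 = a 3) := by
  rintro ⟨h01, h23⟩
  have : CharP L 2 := charP_of_injective_algebraMap (algebraMap K L).injective 2
  have hs := h.sum_eq_zero
  rw [Fin.sum_univ_four] at hs hsum
  have hx := h.ne_zero
  have hx01 : x 0 + x 1 ≠ 0 := fun h0 => by simpa using h.injective (CharTwo.add_eq_zero.1 h0)
  have hprod : algebraMap K L (a 0) * (x 2 * x 3) = algebraMap K L (a 2) * (x 0 * x 1) := by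
    rw [← h01, ← h23] at hsum
    field_simp [hx 0, hx 1, hx 2, hx 3] at hsum
    refine mul_left_cancel₀ hx01 ?_
    grind
  have ha02 : a 0 = a 2 := by
    have hnorm := congrArg (Algebra.norm K) hprod
    simp only [map_mul, Algebra.norm_algebraMap, h5, ← (ha _).2, ← h01, ← h23] at hnorm
    have := (ha 0).1
    have := (ha 2).1
    grind
  have hquad : (x 0 + x 2) * (x 1 + x 2) = 0 := by
    rw [← ha02] at hprod
    have := mul_left_cancel₀ ((_root_.map_ne_zero _).2 (ha 0).1) hprod
    grind
  simp [CharTwo.add_eq_zero, h.injective.eq_iff] at hquad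

end Paired

section QuadraticFamily

theorem univ_erase_fin_four (i : Fin 4) :
    (Finset.univ.erase i : Finset (Fin 4)) = {i + 1, i + 2, i + 3} := by
  decide +revert

theorem coeffDet_ne_zero_of_linearIndependent {K : Type*} [Field K] {Q : Fin 3 → K[X]}
    (hQ : ∀ i, (Q i).natDegree ≤ 2) (h : LinearIndependent K Q) :
    coeffDet (Q 0) (Q 1) (Q 2) ≠ 0 := by
  rw [coeffDet, Ne, ← Matrix.exists_vecMul_eq_zero_iff]
  rintro ⟨v, hv0, hv⟩
  refine hv0 (funext (Fintype.linearIndependent_iff.1 h v ?_))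
  ext n
  rw [finsetSum_coeff, coeff_zero]
  rcases lt_or_ge n 3 with hn | hn
  · simpa [Matrix.vecMul_eq_sum, Fin.sum_univ_three] using congrFun hv ⟨n, hn⟩
  · exact Finset.sum_eq_zero fun i _ => by
      rw [coeff_smul, coeff_eq_zero_of_natDegree_lt ((hQ i).trans_lt hn), smul_zero]

namespace IsVanishingFamily

variable {K L : Type*} [Field K] [Field L] [Algebra K L]

theorem apply_three [CharP K 2] {x : Fin 4 → L} (h : IsVanishingFamily K x) :
    x 3 = x 0 + x 1 + x 2 := by
  have : CharP L 2 := charP_of_injective_algebraMap (algebraMap K L).injective 2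
  have hsum := h.sum_eq_zero
  rw [Fin.sum_univ_four, CharTwo.add_eq_zero] at hsum
  exact hsum.symm

theorem exists_quadratic_parametrization [PerfectField K] [CharP K 2]
    (h5 : Module.finrank K L = 5) {x : Fin 4 → L} (h : IsVanishingFamily K x) :
    ∃ (pb : PowerBasis K L) (Q : Fin 4 → K[X]), (∀ i, (Q i).natDegree ≤ 2) ∧
      IsVanishingFamily K fun i => aeval pb.gen (Q i) := by
  have : FiniteDimensional K L := Module.finite_of_finrank_pos (h5 ▸ Nat.succ_pos 4)
  obtain ⟨μ, pb, Q, hμ, hQ⟩ :=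
    _root_.exists_quadratic_parametrization h5 (h.linearIndependent_comp_castSucc h5)
  refine ⟨pb, Fin.snoc Q (∑ i, Q i), Fin.lastCases ?_ fun i => ?_, h.of_eq_mul hμ
    (Fin.lastCases ?_ fun i => ?_)⟩
  · rw [Fin.snoc_last]
    exact natDegree_sum_le_of_forall_le _ _ fun i _ => (hQ i).1
  · rw [Fin.snoc_castSucc]
    exact (hQ i).1
  · have hQ' := fun i => (hQ i).2.symm
    rw [Fin.snoc_last, map_sum, Finset.mul_sum, Finset.sum_congr rfl fun i _ => hQ' i,
      Fin.sum_univ_three]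
    exact h.apply_three
  · rw [Fin.snoc_castSucc]
    exact (hQ i).2

variable {pb : PowerBasis K L} {Q : Fin 4 → K[X]}

theorem sum_polynomial_eq_zero (hdim : 2 < pb.dim) (hQ : ∀ i, (Q i).natDegree ≤ 2)
    (h : IsVanishingFamily K fun i => aeval pb.gen (Q i)) : ∑ i, Q i = 0 :=
  eq_zero_of_aeval_gen_eq_zero pb
    ((natDegree_sum_le_of_forall_le _ _ fun i _ => hQ i).trans_lt hdim)
    (by rw [map_sum, h.sum_eq_zero])

theorem coeffDet_ne_zero [PerfectField K] [CharP K 2] (h5 : Module.finrank K L = 5)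
    (hQ : ∀ i, (Q i).natDegree ≤ 2) (h : IsVanishingFamily K fun i => aeval pb.gen (Q i)) :
    coeffDet (Q 0) (Q 1) (Q 2) ≠ 0 :=
  coeffDet_ne_zero_of_linearIndependent (Q := Q ∘ Fin.castSucc) (fun _ => hQ _)
    (.of_comp (aeval pb.gen).toLinearMap (h.linearIndependent_comp_castSucc h5))

theorem exists_cofactor [PerfectField K] [CharP K 2] (h5 : Module.finrank K L = 5)
    (hQ : ∀ i, (Q i).natDegree ≤ 2) (h : IsVanishingFamily K fun i => aeval pb.gen (Q i)) :
    ∃ l : K[X], ∀ i,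
      resultant l (Q i) 1 2 = ∏ j ∈ Finset.univ.erase i, resultant (Q j) (Q i) 2 2 := by
  have : FiniteDimensional K L := Module.finite_of_finrank_pos (h5 ▸ Nat.succ_pos 4)
  have hdim : pb.dim = 5 := pb.finrank ▸ h5
  obtain ⟨a, ha, hsum⟩ := h.exists_sqrt_norm
  have hcard (i : Fin 4) : ∑ _j ∈ Finset.univ.erase i, 2 = pb.dim + 1 := by simp [hdim]
  obtain ⟨l, hl, hS⟩ := exists_numerator_eq_minpoly_mul (a := a) (Q := Q) pb (e := 1)
    (natDegree_numerator_le hQ fun i => (hcard i).le)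
    (by rw [aeval_numerator a h.ne_zero, hsum, mul_zero])
  refine ⟨l, fun i => mul_left_cancel₀ (pow_ne_zero 2 (ha i).1) ?_⟩
  rw [← norm_mul_resultant_cofactor hQ hl hS (fun _ => le_rfl) (hcard i), (ha i).2]

theorem exists_resultant_eq_zero [PerfectField K] [CharP K 2] (h5 : Module.finrank K L = 5)
    (hQ : ∀ i, (Q i).natDegree ≤ 2) (h : IsVanishingFamily K fun i => aeval pb.gen (Q i)) :
    ∃ i j, i ≠ j ∧ resultant (Q i) (Q j) 2 2 = 0 := by
  by_contra! hne
  have hdim : pb.dim = 5 := pb.finrank ▸ h5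
  obtain ⟨l, hl⟩ := h.exists_cofactor h5 hQ
  have hQ3 : Q 0 + Q 1 + Q 2 = Q 3 := by
    have := h.sum_polynomial_eq_zero (by omega) hQ
    rwa [Fin.sum_univ_four, CharTwo.add_eq_zero] at this
  refine h.coeffDet_ne_zero h5 hQ (coeffDet_eq_zero_of_residual (l := l) (hne 0 1 (by decide))
    (hne 0 2 (by decide)) (hne 1 2 (by decide)) (hQ3.symm ▸ hne 0 3 (by decide))
    (hQ3.symm ▸ hne 1 3 (by decide)) (hQ3.symm ▸ hne 2 3 (by decide)) ?_ ?_ ?_ ?_)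
  all_goals rw [hQ3]
  · simpa [univ_erase_fin_four, resultant_two_two_comm (Q 0), mul_assoc] using hl 0
  · simpa [univ_erase_fin_four, resultant_two_two_comm (Q 1), mul_comm, mul_left_comm,
      mul_assoc] using hl 1
  · simpa [univ_erase_fin_four, resultant_two_two_comm (Q 2), mul_comm, mul_left_comm,
      mul_assoc] using hl 2
  · simpa [univ_erase_fin_four, mul_assoc] using hl 3

end IsVanishingFamily

end QuadraticFamily

section NormalForm

theorem aeval_eq_resultant_map {K L : Type*} [Field K] [CommRing L] [Algebra K L] {p : K[X]}
    (hp : p.natDegree ≤ 2) (t : L) :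
    aeval t p = resultant (X - C t) (p.map (algebraMap K L)) 1 2 := by
  rw [resultant_one_two, aeval_eq_sum_range' (Nat.lt_succ_of_le hp)]
  simp [Finset.sum_range_succ, Algebra.smul_def]
  ring

theorem coeffDet_map {R S : Type*} [CommRing R] [CommRing S] (f : R →+* S) (p q r : R[X]) :
    coeffDet (p.map f) (q.map f) (r.map f) = f (coeffDet p q r) := by
  simp [coeffDet_eq]

theorem exists_linear_mul_aeval_eq {K L : Type*} [Field K] [CharP K 2] [Field L] [Algebra K L]
    {p q r : K[X]} (hp : p.natDegree ≤ 2) (hq : q.natDegree ≤ 2) (hr : r.natDegree ≤ 2)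
    (hdet : coeffDet p q r ≠ 0) (hpq : resultant p q 2 2 = 0) (t : L) :
    ∃ α β A B E : K, (α ≠ 0 ∨ β ≠ 0) ∧
      (α • aeval t p + β • aeval t q) * aeval t r =
        A • aeval t p ^ 2 + B • aeval t q ^ 2 + E • (aeval t p * aeval t q) := by
  have : CharP L 2 := charP_of_injective_algebraMap (algebraMap K L).injective 2
  refine ⟨coeffDet p q r * q.coeff 1, coeffDet p q r * p.coeff 1, resultant q r 2 2,
    resultant p r 2 2, coeffDet p q r * r.coeff 1, ?_, ?_⟩
  · by_contra! h
    have hsq := coeffDet_sq p q r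
    simp only [mul_eq_zero, hdet, false_or] at h
    simp [hpq, h.1, h.2, hdet] at hsq
  · have := conic_identity _ _ _ _ (aeval_eq_resultant_map hp t) (aeval_eq_resultant_map hq t)
      (aeval_eq_resultant_map hr t)
    simp only [resultant_map_map, coeffDet_map, coeff_map, hpq, map_zero] at this
    simp only [Algebra.smul_def, map_mul]
    grind

/-- The quadruple of polynomials `X`, `c X + 1`, `u X ^ 2 + v X + w` and their sum in
characteristic two, the normal form of a quadratic family with a vanishing resultant. -/
noncomputable def degenerateQuadruple {R : Type*} [CommRing R] (c u v w : R) : Fin 4 → R[X] :=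
  ![X, C c * X + 1, C u * X ^ 2 + C v * X + C w, C u * X ^ 2 + C (v + c + 1) * X + C (w + 1)]

theorem exists_quadratic_of_linear_mul_eq {K L : Type*} [Field K] [CharP K 2] [Field L]
    [Algebra K L] {x y z : L} {α β A B E : K} (hβ : β ≠ 0) (hne : α • x + β • y ≠ 0)
    (h : (α • x + β • y) * z = A • x ^ 2 + B • y ^ 2 + E • (x * y)) :
    ∃ (μ θ : L) (c u v w : K), μ ≠ 0 ∧ x = μ * θ ∧ y = μ * (c • θ + 1) ∧
      z = μ * (u • θ ^ 2 + v • θ + algebraMap K L w) := by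
  have : CharP L 2 := charP_of_injective_algebraMap (algebraMap K L).injective 2
  have hβL : algebraMap K L β ≠ 0 := (_root_.map_ne_zero _).2 hβ
  obtain ⟨c, rfl⟩ : ∃ c, α = β * c := ⟨α / β, (mul_div_cancel₀ _ hβ).symm⟩
  simp only [Algebra.smul_def, map_mul] at hne h ⊢
  obtain ⟨μ, hμ⟩ : ∃ μ, algebraMap K L c * x + y = μ := ⟨_, rfl⟩
  have hμ0 : μ ≠ 0 := fun h0 => hne (by rw [mul_assoc, ← mul_add, hμ, h0, mul_zero])
  obtain ⟨θ, rfl⟩ : ∃ θ, x = μ * θ := ⟨x / μ, (mul_div_cancel₀ _ hμ0).symm⟩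
  obtain rfl : y = μ * (algebraMap K L c * θ + 1) := by grind
  refine ⟨μ, θ, c, (A + B * c ^ 2 + E * c) / β, E / β, B / β, hμ0, rfl, rfl, ?_⟩
  refine mul_left_cancel₀ (mul_ne_zero hβL hμ0) ?_
  rw [mul_assoc, ← mul_add, hμ] at h
  rw [h]
  simp only [map_div₀, map_add, map_mul, map_pow]
  field_simp
  grind

theorem IsVanishingFamily.exists_degenerateQuadruple {K L : Type*} [Field K] [CharP K 2] [Field L]
    [Algebra K L] (hp : (Module.finrank K L).Prime) {x : Fin 4 → L} (h : IsVanishingFamily K x)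
    (hx : LinearIndependent K (x ∘ Fin.castSucc)) {α β A B E : K} (hβ : β ≠ 0)
    (hconic : (α • x 0 + β • x 1) * x 2 = A • x 0 ^ 2 + B • x 1 ^ 2 + E • (x 0 * x 1)) :
    ∃ (pb : PowerBasis K L) (c u v w : K),
      IsVanishingFamily K fun i => aeval pb.gen (degenerateQuadruple c u v w i) := by
  have : CharP L 2 := charP_of_injective_algebraMap (algebraMap K L).injective 2
  have : FiniteDimensional K L := Module.finite_of_finrank_pos hp.pos
  have hli (a b : K) (hab : a • x 0 + b • x 1 = 0) : b = 0 := by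
    simpa using Fintype.linearIndependent_iff.1 hx ![a, b, 0]
      (by simpa [Fin.sum_univ_three] using hab) 1
  obtain ⟨μ, θ, c, u, v, w, hμ, h0, h1, h2⟩ :=
    exists_quadratic_of_linear_mul_eq hβ (fun h0 => hβ (hli α β h0)) hconic
  have hθ : θ ∉ Set.range (algebraMap K L) := by
    rintro ⟨k, rfl⟩
    have hk : k = 0 := hli (1 + k * c) k (by
      rw [h0, h1]
      simp only [Algebra.smul_def, map_add, map_mul, map_one]
      grind)
    exact h.ne_zero 0 (by rw [h0, hk, map_zero, mul_zero])
  obtain ⟨pb, rfl⟩ := exists_powerBasis_gen_eq hp hθ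
  refine ⟨pb, c, u, v, w, h.of_eq_mul hμ fun i => ?_⟩
  fin_cases i
  · simp [degenerateQuadruple, h0]
  · simp [degenerateQuadruple, h1, Algebra.smul_def]
  · simp [degenerateQuadruple, h2, Algebra.smul_def]
  · suffices x 3 = μ * (algebraMap K L u * pb.gen ^ 2 +
        (algebraMap K L v + algebraMap K L c + 1) * pb.gen + (algebraMap K L w + 1)) by
      simpa [degenerateQuadruple] using this
    simp only [h.apply_three, h0, h1, h2, Algebra.smul_def]
    ring

end NormalForm

section Degenerate

theorem resultant_two_one {R : Type*} [CommRing R] (q l : R[X]) :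
    resultant q l 2 1 = q.coeff 2 * l.coeff 0 ^ 2 - q.coeff 1 * l.coeff 0 * l.coeff 1 +
      q.coeff 0 * l.coeff 1 ^ 2 := by
  rw [resultant_comm, resultant_one_two, (by decide : Even (2 * 1)).neg_one_pow, one_mul]

theorem natDegree_degenerateQuadruple_le {R : Type*} [CommRing R] (c u v w : R) (i : Fin 4) :
    (degenerateQuadruple c u v w i).natDegree ≤ ![1, 1, 2, 2] i := by
  fin_cases i
  · exact natDegree_X_le
  · exact natDegree_linear_le
  · exact natDegree_quadratic_le
  · exact natDegree_quadratic_le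

theorem degenerateQuadruple_one_swap {R : Type*} [CommRing R] [CharP R 2] (c u v : R) (i : Fin 4) :
    degenerateQuadruple c u v 1 (Equiv.swap 2 3 i) =
      degenerateQuadruple c u (v + c + 1) 0 i := by
  have h : v + c + 1 + c + 1 = v := by grind
  fin_cases i
  · simp [degenerateQuadruple, Equiv.swap_apply_of_ne_of_ne]
  · simp [degenerateQuadruple, Equiv.swap_apply_of_ne_of_ne]
  · simp [degenerateQuadruple, CharTwo.add_self_eq_zero]
  · simp [degenerateQuadruple, h, -map_add]

theorem numerator_degenerateQuadruple {R : Type*} [CommRing R] (a : Fin 4 → R) (c u v w : R) :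
    numerator a (degenerateQuadruple c u v w) =
      C ((a 0 * c + a 1) * u ^ 2) * X ^ 5 +
      C ((a 0 * c + a 1) * (u * (v + (v + c + 1))) + a 0 * u ^ 2 + c * u * (a 2 + a 3)) * X ^ 4 +
      C ((a 0 * c + a 1) * (u * (w + (w + 1)) + v * (v + c + 1)) + a 0 * (u * (v + (v + c + 1))) +
        a 2 * (u + c * (v + c + 1)) + a 3 * (u + c * v)) * X ^ 3 +
      C ((a 0 * c + a 1) * (v * (w + 1) + w * (v + c + 1)) +
        a 0 * (u * (w + (w + 1)) + v * (v + c + 1)) + a 2 * (v + c + 1 + c * (w + 1)) +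
        a 3 * (v + c * w)) * X ^ 2 +
      C ((a 0 * c + a 1) * (w * (w + 1)) + a 0 * (v * (w + 1) + w * (v + c + 1)) + a 2 * (w + 1) +
        a 3 * w) * X +
      C (a 0 * (w * (w + 1))) := by
  simp [numerator, Fin.sum_univ_four, univ_erase_fin_four, degenerateQuadruple]
  ring

-- `ε` is the constant cofactor of the minimal polynomial in the numerator: `h₀`, `h₁`, `h₂`, `h₃`
-- come from resultants and `h` from the leading coefficient.
theorem degenerate_cofactor_eq_zero {K : Type*} [Field K] [CharP K 2] {c u v w r ε a₀ a₁ : K}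
    (hu : u ≠ 0) (ha₀ : a₀ ≠ 0) (ha₁ : a₁ ≠ 0) (hr : r = c ^ 2 * w + c * v + u)
    (h₀ : w * (w + 1) = ε * a₀) (h₁ : r * (r + c) = ε * a₁)
    (h₂ : ε ^ 2 = u ^ 2 * (w * r * (r + w + v)))
    (h₃ : ε ^ 2 = u ^ 2 * ((w + 1) * (r + c) * (r + w + v))) (h : ε = (a₀ * c + a₁) * u ^ 2) :
    ε = 0 := by
  by_contra hε
  have hu2 := pow_ne_zero 2 hu
  have hw : w ≠ 0 := left_ne_zero_of_mul (h₀ ▸ mul_ne_zero hε ha₀)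
  have hr0 : r ≠ 0 := left_ne_zero_of_mul (h₁ ▸ mul_ne_zero hε ha₁)
  have hs : r + w + v ≠ 0 := by
    intro hs
    rw [hs, mul_zero, mul_zero] at h₂
    exact pow_ne_zero 2 hε h₂
  have hrc : r = c * (w + 1) := by
    have := mul_right_cancel₀ hs (mul_left_cancel₀ hu2 (h₂.symm.trans h₃))
    clear * - this
    grind
  have hprod : w * r * (r + w + v) = c * (w * (w + 1)) + r * (r + c) := by
    refine mul_left_cancel₀ hu2 ?_
    rw [← h₂, h₀, h₁]
    linear_combination ε * h
  have hsc : r + w + v = c + 1 := by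
    refine mul_left_cancel₀ (mul_ne_zero hw hr0) ?_
    rw [hprod, hrc]
    clear * -
    grind
  clear * - hr hrc hsc hu
  grind

theorem natDegree_numerator_degenerateQuadruple_le {R : Type*} [CommRing R] (a : Fin 4 → R)
    (c u v w : R) : (numerator a (degenerateQuadruple c u v w)).natDegree ≤ 5 := by
  rw [numerator_degenerateQuadruple]
  compute_degree

namespace IsVanishingFamily

variable {K L : Type*} [Field K] [PerfectField K] [CharP K 2] [Field L] [Algebra K L]
  {pb : PowerBasis K L} {c u v w : K}

theorem degenerateQuadruple_coeff_ne_zero (h5 : Module.finrank K L = 5)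
    (h : IsVanishingFamily K fun i => aeval pb.gen (degenerateQuadruple c u v w i)) : u ≠ 0 := by
  rintro rfl
  refine h.coeffDet_ne_zero h5 (fun i => (natDegree_degenerateQuadruple_le c 0 v w i).trans ?_) ?_
  · fin_cases i <;> simp
  · simp [coeffDet_eq, degenerateQuadruple, coeff_X, coeff_one]

theorem exists_degenerate_cofactor (h5 : Module.finrank K L = 5)
    (h : IsVanishingFamily K fun i => aeval pb.gen (degenerateQuadruple c u v w i)) {a : Fin 4 → K}
    (ha : ∀ i, a i ≠ 0 ∧ a i ^ 2 = Algebra.norm K (aeval pb.gen (degenerateQuadruple c u v w i)))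
    (hsum : ∑ i, algebraMap K L (a i) / aeval pb.gen (degenerateQuadruple c u v w i) = 0) {r : K}
    (hr : r = c ^ 2 * w + c * v + u) :
    ∃ ε : K, numerator a (degenerateQuadruple c u v w) = minpoly K pb.gen * C ε ∧
      w * (w + 1) = ε * a 0 ∧ r * (r + c) = ε * a 1 ∧ ε ^ 2 = u ^ 2 * (w * r * (r + w + v)) ∧
      ε ^ 2 = u ^ 2 * ((w + 1) * (r + c) * (r + w + v)) := by
  have : FiniteDimensional K L := Module.finite_of_finrank_pos (h5 ▸ Nat.succ_pos 4)
  have hdim : pb.dim = 5 := pb.finrank ▸ h5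
  have hu := h.degenerateQuadruple_coeff_ne_zero h5
  have hQ := natDegree_degenerateQuadruple_le c u v w
  have hQ2 (i) : (degenerateQuadruple c u v w i).natDegree ≤ 2 :=
    (hQ i).trans (by fin_cases i <;> simp)
  obtain ⟨l, hl, hS⟩ := exists_numerator_eq_minpoly_mul (a := a) (Q := degenerateQuadruple c u v w)
    pb (e := 0) (hdim ▸ natDegree_numerator_degenerateQuadruple_le a c u v w)
    (by rw [aeval_numerator a h.ne_zero, hsum, mul_zero])
  obtain ⟨ε, rfl⟩ := natDegree_eq_zero.1 (Nat.le_zero.1 hl)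
  have hlinear (i) := norm_mul_resultant_cofactor hQ hl hS (i := i)
  have hquadratic (i) := norm_mul_resultant_cofactor hQ2 (hl.trans zero_le_one) hS (i := i)
    (fun _ => le_rfl) (by simp [hdim])
  simp only [← (ha _).2, univ_erase_fin_four, hdim] at hlinear hquadratic
  have h₀ : a 0 ^ 2 * ε = -(a 0 * (w * (w + 1))) := by
    simpa [resultant_one_one, resultant_two_one, degenerateQuadruple, coeff_X, coeff_one] using
      hlinear 0 (by decide) (by simp)
  have h₁ : a 1 ^ 2 * ε =
      a 1 * ((u - v * c + w * c ^ 2) * (u - (v + c + 1) * c + (w + 1) * c ^ 2)) := by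
    simpa [resultant_one_one, resultant_two_one, degenerateQuadruple, coeff_X, coeff_one] using
      hlinear 1 (by decide) (by simp)
  have h₂ : u * ε ^ 2 =
      ((u * w - (w + 1) * u) ^ 2 - (u * v - (v + c + 1) * u) * ((v + c + 1) * w - (w + 1) * v)) *
        (u * w * (u ^ 2 + c * u * (c * w - v))) := by
    simpa [resultant_two_two, resultant_one_two, degenerateQuadruple, coeff_X, coeff_one] using
      mul_left_cancel₀ (pow_ne_zero 2 (ha 2).1) (hquadratic 2)
  have h₃ : u * ε ^ 2 =
      u * (w + 1) * ((u ^ 2 + c * u * (c * (w + 1) - (v + c + 1))) *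
        ((u * (w + 1) - w * u) ^ 2 -
          (u * (v + c + 1) - v * u) * (v * (w + 1) - w * (v + c + 1)))) := by
    simpa [resultant_two_two, resultant_one_two, degenerateQuadruple, coeff_X, coeff_one] using
      mul_left_cancel₀ (pow_ne_zero 2 (ha 3).1) (hquadratic 3)
  refine ⟨ε, hS, mul_left_cancel₀ (ha 0).1 ?_, mul_left_cancel₀ (ha 1).1 ?_, mul_left_cancel₀ hu ?_,
    mul_left_cancel₀ hu ?_⟩
  · clear * - h₀
    grind
  · clear * - h₁ hr
    grind
  · clear * - h₂ hr
    grind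
  · clear * - h₃ hr
    grind

theorem numerator_degenerateQuadruple_eq_zero (h5 : Module.finrank K L = 5)
    (h : IsVanishingFamily K fun i => aeval pb.gen (degenerateQuadruple c u v w i)) {a : Fin 4 → K}
    (ha : ∀ i, a i ≠ 0 ∧ a i ^ 2 = Algebra.norm K (aeval pb.gen (degenerateQuadruple c u v w i)))
    (hsum : ∑ i, algebraMap K L (a i) / aeval pb.gen (degenerateQuadruple c u v w i) = 0) :
    numerator a (degenerateQuadruple c u v w) = 0 ∧ w * (w + 1) = 0 ∧
      (c ^ 2 * w + c * v + u) * (c ^ 2 * w + c * v + u + c) = 0 := by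
  have : FiniteDimensional K L := Module.finite_of_finrank_pos (h5 ▸ Nat.succ_pos 4)
  have hmonic := minpoly.monic pb.isIntegral_gen
  have hdeg : (minpoly K pb.gen).natDegree = 5 := pb.natDegree_minpoly.trans (pb.finrank ▸ h5)
  obtain ⟨ε, hS, h₀, h₁, h₂, h₃⟩ := h.exists_degenerate_cofactor h5 ha hsum rfl
  have hε : ε = (a 0 * c + a 1) * u ^ 2 := by
    have hcoeff := congrArg (coeff · 5) hS
    simp only [coeff_mul_C] at hcoeff
    rw [← hdeg, hmonic.coeff_natDegree, hdeg, one_mul, numerator_degenerateQuadruple] at hcoeff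
    simp only [coeff_add, coeff_C_mul, coeff_X_pow, coeff_X, coeff_C] at hcoeff
    simpa using hcoeff.symm
  obtain rfl := degenerate_cofactor_eq_zero (h.degenerateQuadruple_coeff_ne_zero h5) (ha 0).1
    (ha 1).1 rfl h₀ h₁ h₂ h₃ hε
  exact ⟨by rw [hS, C_0, mul_zero], by rw [h₀, zero_mul], by rw [h₁, zero_mul]⟩

theorem not_degenerateQuadruple_zero (h5 : Module.finrank K L = 5) (c u v : K) :
    ¬ IsVanishingFamily K fun i => aeval pb.gen (degenerateQuadruple c u v 0 i) := by
  intro h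
  have : FiniteDimensional K L := Module.finite_of_finrank_pos (h5 ▸ Nat.succ_pos 4)
  have hu := h.degenerateQuadruple_coeff_ne_zero h5
  obtain ⟨a, ha, hsum⟩ := h.exists_sqrt_norm
  obtain ⟨hS, -, hr⟩ := h.numerator_degenerateQuadruple_eq_zero h5 ha hsum
  have hcoeff (n : ℕ) := congrArg (coeff · n) hS
  simp only [numerator_degenerateQuadruple, coeff_add, coeff_C_mul, coeff_X_pow, coeff_X, coeff_C,
    coeff_zero] at hcoeff
  have h₁ : a 2 = a 0 * v := Eq.symm <| by
    simpa [CharTwo.add_eq_zero] using hcoeff 1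
  have h₅ : a 1 = a 0 * c := Eq.symm <| by
    simpa [hu, CharTwo.add_eq_zero] using hcoeff 5
  have h₂ : a 0 * (u + v * (v + c + 1)) + a 2 * (v + c + 1 + c) + a 3 * v = 0 := by
    simpa [h₅, CharTwo.add_self_eq_zero] using hcoeff 2
  have h₄ : a 0 * u ^ 2 + c * u * (a 2 + a 3) = 0 := by
    simpa [h₅, CharTwo.add_self_eq_zero] using hcoeff 4
  have hc : c ≠ 0 := right_ne_zero_of_mul (h₅ ▸ (ha 1).1)
  have hu' : a 0 * u = c * (a 2 + a 3) :=
    mul_left_cancel₀ hu (by linear_combination CharTwo.add_eq_zero.1 h₄)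
  obtain ⟨h03, h12⟩ : a 0 = a 3 ∧ a 1 = a 2 := by
    have ha0 := (ha 0).1
    have ha3 := (ha 3).1
    clear * - h₁ h₂ h₅ hu' hc hr ha0 ha3
    grind
  refine (h.comp (Equiv.swap 1 3)).not_paired h5 (a := a ∘ Equiv.swap 1 3) (fun i => ha _)
    ((Equiv.sum_comp (Equiv.swap 1 3) _).trans hsum) ⟨h03, h12.symm⟩

theorem not_degenerateQuadruple (h5 : Module.finrank K L = 5) (c u v w : K) :
    ¬ IsVanishingFamily K fun i => aeval pb.gen (degenerateQuadruple c u v w i) := by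
  intro h
  have : FiniteDimensional K L := Module.finite_of_finrank_pos (h5 ▸ Nat.succ_pos 4)
  obtain ⟨a, ha, hsum⟩ := h.exists_sqrt_norm
  obtain ⟨-, hw, -⟩ := h.numerator_degenerateQuadruple_eq_zero h5 ha hsum
  rcases mul_eq_zero.1 hw with rfl | hw
  · exact not_degenerateQuadruple_zero h5 c u v h
  obtain rfl := CharTwo.add_eq_zero.1 hw
  refine not_degenerateQuadruple_zero (pb := pb) h5 c u (v + c + 1) ?_
  simp only [← degenerateQuadruple_one_swap]
  exact h.comp (Equiv.swap 2 3)

theorem not_fin_four (h5 : Module.finrank K L = 5) (x : Fin 4 → L) : ¬ IsVanishingFamily K x := by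
  intro hx
  have hp : (Module.finrank K L).Prime := h5 ▸ Nat.prime_five
  obtain ⟨pb, Q, hQ, h⟩ := hx.exists_quadratic_parametrization h5
  obtain ⟨i, j, hij, hres⟩ := h.exists_resultant_eq_zero h5 hQ
  obtain ⟨σ, rfl, rfl⟩ : ∃ σ : Equiv.Perm (Fin 4), σ 0 = i ∧ σ 1 = j :=
    MulAction.is_two_pretransitive_iff.1 (Equiv.Perm.isMultiplyPretransitive _ _)
      (by decide : (0 : Fin 4) ≠ 1) hij
  have hσ := h.comp σ
  obtain ⟨α, β, A, B, E, hαβ, hconic⟩ := exists_linear_mul_aeval_eq (hQ (σ 0)) (hQ (σ 1))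
    (hQ (σ 2)) (hσ.coeffDet_ne_zero (Q := Q ∘ σ) h5 (fun i => hQ _)) hres pb.gen
  obtain ⟨pb', c, u, v, w, h'⟩ : ∃ (pb : PowerBasis K L) (c u v w : K),
      IsVanishingFamily K fun i => aeval pb.gen (degenerateQuadruple c u v w i) := by
    rcases ne_or_eq β 0 with hβ | rfl
    · exact hσ.exists_degenerateQuadruple hp (hσ.linearIndependent_comp_castSucc h5) hβ hconic
    · have hτ := hσ.comp (Equiv.swap 0 1)
      refine hτ.exists_degenerateQuadruple hp (hτ.linearIndependent_comp_castSucc h5)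
        (hαβ.resolve_right (· rfl)) (α := 0) (A := B) (B := A) (E := E) ?_
      simpa [Equiv.swap_apply_def, mul_comm, add_comm, add_left_comm] using hconic
  exact not_degenerateQuadruple h5 c u v w h'

end IsVanishingFamily
end Degenerate

section NormDivSq

variable {K L : Type*} [Field K] [Field L] [Algebra K L]

theorem normDivSq_algEquiv (σ : L ≃ₐ[K] L) (x : L) : normDivSq K (σ x) = σ (normDivSq K x) := by
  rw [normDivSq, normDivSq, map_div₀, map_pow, AlgEquiv.commutes,
    ← Algebra.norm_eq_of_algEquiv σ x]

theorem norm_normDivSq (h5 : Module.finrank K L = 5) (x : L) :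
    Algebra.norm K (normDivSq K x) = Algebra.norm K x ^ 3 := by
  have : FiniteDimensional K L := .of_finrank_pos (by omega)
  rcases eq_or_ne x 0 with rfl | hx
  · rw [normDivSq_zero, Algebra.norm_zero, zero_pow three_ne_zero]
  · have h := congrArg (Algebra.norm K) <|
      div_mul_cancel₀ (algebraMap K L (Algebra.norm K x)) (pow_ne_zero 2 hx)
    rw [map_mul, Algebra.norm_algebraMap, h5, map_pow, pow_add _ 3 2] at h
    exact mul_right_cancel₀ (pow_ne_zero 2 (Algebra.norm_ne_zero_iff.2 hx)) h

variable [CharP K 2]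

theorem normDivSq_injective (h5 : Module.finrank K L = 5)
    (hcube : Function.Injective fun c : K => c ^ 3) :
    Function.Injective (normDivSq K : L → L) := by
  have : FiniteDimensional K L := .of_finrank_pos (by omega)
  have : CharP L 2 := charP_of_injective_algebraMap (algebraMap K L).injective 2
  intro x y h
  have hnorm : Algebra.norm K x = Algebra.norm K y :=
    hcube <| by simp only [← norm_normDivSq h5, h]
  rcases eq_or_ne (Algebra.norm K x) 0 with h0 | h0
  · rw [Algebra.norm_eq_zero_iff.1 h0, Algebra.norm_eq_zero_iff.1 (hnorm.symm.trans h0)]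
  · rw [normDivSq, normDivSq, ← hnorm] at h
    rw [div_eq_mul_inv, div_eq_mul_inv] at h
    exact CharTwo.sq_inj.1 <| inv_injective <|
      mul_left_cancel₀ ((_root_.map_ne_zero (algebraMap K L)).2 h0) h

theorem mem_range_of_normDivSq_mem_range (h5 : Module.finrank K L = 5)
    (hcube : Function.Bijective fun c : K => c ^ 3) {x : L}
    (hx : normDivSq K x ∈ Set.range (algebraMap K L)) : x ∈ Set.range (algebraMap K L) := by
  obtain ⟨c, hc⟩ := hx
  obtain ⟨b, rfl⟩ := hcube.surjective c
  exact ⟨b, normDivSq_injective h5 hcube.injective ((normDivSq_algebraMap h5 b).trans hc)⟩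

variable [PerfectField K]

theorem sum_normDivSq_ne_zero (h5 : Module.finrank K L = 5) {x : Fin 4 → L}
    (hx : Function.Injective x) (hs : ∑ i, x i = 0) : ∑ i, normDivSq K (x i) ≠ 0 := by
  intro h
  by_cases h0 : ∀ i, x i ≠ 0
  · exact IsVanishingFamily.not_fin_four h5 x ⟨hx, h0, hs, h⟩
  obtain ⟨i, hi⟩ := not_forall_not.1 h0
  rw [Fin.sum_univ_succAbove _ i, hi, zero_add] at hs
  rw [Fin.sum_univ_succAbove _ i, hi, normDivSq_zero, zero_add] at h
  refine IsVanishingFamily.not_fin_three h5 (x ∘ i.succAbove)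
    ⟨hx.comp Fin.succAbove_right_injective, fun j hj => ?_, hs, h⟩
  exact Fin.succAbove_ne i j (hx (hj.trans hi.symm))

theorem eq_or_eq_add_of_normDivSq_add_eq (h5 : Module.finrank K L = 5) {a x y : L} (ha : a ≠ 0)
    (h : normDivSq K (x + a) + normDivSq K x = normDivSq K (y + a) + normDivSq K y) :
    y = x ∨ y = x + a := by
  have : CharP L 2 := charP_of_injective_algebraMap (algebraMap K L).injective 2
  by_contra! hne
  refine sum_normDivSq_ne_zero (K := K) h5 (x := ![x, x + a, y, y + a]) ?_ ?_ ?_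
  · rw [← List.nodup_ofFn]
    have hx : x ≠ y + a := fun h => hne.2 (by rw [h, CharTwo.add_cancel_right])
    simp [ha, hne.1.symm, hne.2.symm, hx]
  · simp only [Fin.sum_univ_four, Matrix.cons_val]
    grind
  · simp only [Fin.sum_univ_four, Matrix.cons_val]
    grind

theorem mem_range_of_normDivSq_add_eq [IsGalois K L] (h5 : Module.finrank K L = 5) {a b : K}
    (ha : a ≠ 0) {x : L}
    (h : normDivSq K (x + algebraMap K L a) + normDivSq K x = algebraMap K L b) :
    x ∈ Set.range (algebraMap K L) := by
  have : FiniteDimensional K L := .of_finrank_pos (by omega)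
  have : CharP L 2 := charP_of_injective_algebraMap (algebraMap K L).injective 2
  have hfix (σ : L ≃ₐ[K] L) : σ x = x := by
    have hσ : normDivSq K (σ x + algebraMap K L a) + normDivSq K (σ x) = algebraMap K L b := by
      rw [← σ.commutes a, ← map_add, normDivSq_algEquiv, normDivSq_algEquiv, ← map_add, h,
        σ.commutes]
    rcases eq_or_eq_add_of_normDivSq_add_eq h5 ((_root_.map_ne_zero _).2 ha) (h.trans hσ.symm)
      with hx | hx
    · exact hx
    have h₂ : σ (σ x) = x := by
      rw [hx, map_add, hx, σ.commutes, CharTwo.add_cancel_right]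
    have h₅ : σ ^ 5 = 1 := by
      rw [← h5, ← IsGalois.card_aut_eq_finrank]
      exact pow_card_eq_one'
    simpa only [pow_succ, pow_zero, one_mul, AlgEquiv.mul_apply, h₂, AlgEquiv.one_apply] using
      DFunLike.congr_fun h₅ x
  exact (IsGalois.mem_range_algebraMap_iff_fixed x).2 hfix

theorem eq_of_normDivSq_add_mem_range (h5 : Module.finrank K L = 5) {a : L}
    (ha : a ∉ Set.range (algebraMap K L)) {y z c : K}
    (h : normDivSq K (algebraMap K L y + a) + normDivSq K (algebraMap K L z + a) =
      algebraMap K L c) : y = z := by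
  have : FiniteDimensional K L := .of_finrank_pos (by omega)
  have : CharP L 2 := charP_of_injective_algebraMap (algebraMap K L).injective 2
  obtain ⟨pb, rfl⟩ := exists_powerBasis_gen_eq (by rw [h5]; norm_num) ha
  have hne (y : K) : algebraMap K L y + pb.gen ≠ 0 := fun h0 => ha ⟨y, CharTwo.add_eq_zero.1 h0⟩
  obtain ⟨p, hp⟩ := exists_sq_eq (Algebra.norm K (algebraMap K L y + pb.gen))
  obtain ⟨r, hr⟩ := exists_sq_eq (Algebra.norm K (algebraMap K L z + pb.gen))
  obtain ⟨e, rfl⟩ := exists_sq_eq c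
  have hroot : algebraMap K L p / (algebraMap K L y + pb.gen) +
      algebraMap K L r / (algebraMap K L z + pb.gen) = algebraMap K L e := by
    rw [← CharTwo.sq_inj, CharTwo.add_sq, div_pow, div_pow, ← map_pow, ← map_pow, ← map_pow, hp,
      hr]
    exact h
  have hpoly : C e * X ^ 2 + C (e * (y + z) - (p + r)) * X + C (e * (y * z) - (p * z + r * y)) =
      0 := by
    refine eq_zero_of_aeval_gen_eq_zero pb (natDegree_quadratic_le.trans_lt ?_) ?_
    · rw [← pb.finrank, h5]
      norm_num
    · simp only [map_sub, map_add, map_mul, map_pow, aeval_C, aeval_X, ← hroot]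
      field_simp [hne y, hne z]
      ring
  have he : e = 0 := by simpa using congrArg (coeff · 2) hpoly
  have h₁ : p + r = 0 := by
    simpa [he, CharTwo.sub_eq_add] using congrArg (coeff · 1) hpoly
  have h₀ : p * z + r * y = 0 := by
    simpa [he, CharTwo.sub_eq_add] using congrArg (coeff · 0) hpoly
  have hp₀ : p ≠ 0 := by
    rintro rfl
    exact hne y (Algebra.norm_eq_zero_iff.1 (hp.symm.trans (zero_pow two_ne_zero)))
  rw [← CharTwo.add_eq_zero.1 h₁, ← mul_add, mul_eq_zero_iff_left hp₀] at h₀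
  exact (CharTwo.add_eq_zero.1 h₀).symm

end NormDivSq

section DiffCount

theorem map_add_map_affineEquiv {R V : Type*} [Ring R] [Ring V] [CharP V 2] [Module R V]
    (e : V ≃ᵃ[R] V) (x y : V) : e x + e y = e.linear (x + y) := by
  rw [← CharTwo.sub_eq_add, ← CharTwo.sub_eq_add x]
  exact (e.toAffineMap.linearMap_vsub x y).symm

variable {F : Type*} [Field F] [Fintype F] [DecidableEq F]

theorem diffCount_le_differentialUniformity (f : F → F) {a : F} (ha : a ≠ 0) (b : F) :
    diffCount f a b ≤ differentialUniformity f :=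
  Finset.le_sup (f := fun p : F × F => diffCount f p.1 p.2)
    (Finset.mem_filter.2 ⟨Finset.mem_univ (a, b), ha⟩)

theorem differentialUniformity_le {f : F → F} {n : ℕ}
    (h : ∀ a b, a ≠ 0 → diffCount f a b ≤ n) : differentialUniformity f ≤ n :=
  Finset.sup_le fun p hp => h p.1 p.2 (Finset.mem_filter.1 hp).2

variable [CharP F 2] {R : Type*} [Ring R] [Module R F]

theorem diffCount_affineEquiv_comp (p : F → F) (e₁ e₂ : F ≃ᵃ[R] F) (a b : F) :
    diffCount (fun x => e₁ (p (e₂ x))) a (e₁.linear b) = diffCount p (e₂.linear a) b := by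
  have hshift (x : F) : e₂ (x + a) = e₂ x + e₂.linear a := by
    simpa only [vadd_eq_add, add_comm] using e₂.map_vadd x a
  refine Finset.card_equiv e₂.toEquiv fun x => ?_
  simp only [Finset.mem_filter_univ, hshift, map_add_map_affineEquiv,
    e₁.linear.injective.eq_iff, AffineEquiv.coe_toEquiv]

theorem differentialUniformity_affineEquiv_comp (p : F → F) (e₁ e₂ : F ≃ᵃ[R] F) :
    differentialUniformity (fun x => e₁ (p (e₂ x))) = differentialUniformity p := by
  apply le_antisymm
  · refine differentialUniformity_le fun a b ha => ?_
    obtain ⟨b, rfl⟩ := e₁.linear.surjective b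
    rw [diffCount_affineEquiv_comp]
    exact diffCount_le_differentialUniformity _ (e₂.linear.map_ne_zero_iff.2 ha) _
  · refine differentialUniformity_le fun a b ha => ?_
    obtain ⟨a, rfl⟩ := e₂.linear.surjective a
    rw [← diffCount_affineEquiv_comp p e₁ e₂]
    exact diffCount_le_differentialUniformity _ (e₂.linear.map_ne_zero_iff.1 ha) _

end DiffCount

section Extension

/-- `f` extends `G` from the subfield `K` to `L` by the values of `normDivSq K` off `K`, as the
functions of the theorem do when `K` is finite. -/
structure IsNormDivSqExtension {K L : Type*} [Field K] [Field L] [Algebra K L] (G : K → K)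
    (f : L → L) : Prop where
  apply_algebraMap : ∀ z, f (algebraMap K L z) = algebraMap K L (G z)
  apply_of_notMem : ∀ x ∉ Set.range (algebraMap K L), f x = normDivSq K x

namespace IsNormDivSqExtension

variable {K L : Type*} [Field K] [CharP K 2] [Field L] [Algebra K L] {G : K → K} {f : L → L}

theorem injective (hf : IsNormDivSqExtension G f) (h5 : Module.finrank K L = 5)
    (hcube : Function.Bijective fun c : K => c ^ 3) (hG : Function.Injective G) :
    Function.Injective f := by
  have hmem {x : L} : f x ∈ Set.range (algebraMap K L) ↔ x ∈ Set.range (algebraMap K L) := by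
    refine ⟨fun h => ?_, fun ⟨z, hz⟩ => ⟨G z, by rw [← hz, hf.apply_algebraMap]⟩⟩
    by_contra hx
    rw [hf.apply_of_notMem x hx] at h
    exact hx (mem_range_of_normDivSq_mem_range h5 hcube h)
  intro x y h
  by_cases hx : x ∈ Set.range (algebraMap K L)
  · obtain ⟨w, rfl⟩ := hmem.1 (h ▸ hmem.2 hx)
    obtain ⟨z, rfl⟩ := hx
    rw [hf.apply_algebraMap, hf.apply_algebraMap] at h
    rw [hG ((algebraMap K L).injective h)]
  · have hy : y ∉ Set.range (algebraMap K L) := fun hy => hx (hmem.1 (h ▸ hmem.2 hy))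
    rw [hf.apply_of_notMem x hx, hf.apply_of_notMem y hy] at h
    exact normDivSq_injective h5 hcube.injective h

section Perfect

variable [PerfectField K]

theorem mem_range_of_add_eq [IsGalois K L] (hf : IsNormDivSqExtension G f)
    (h5 : Module.finrank K L = 5) {a b : K} (ha : a ≠ 0) {x : L}
    (h : f (x + algebraMap K L a) + f x = algebraMap K L b) : x ∈ Set.range (algebraMap K L) := by
  by_contra hx
  have hxa : x + algebraMap K L a ∉ Set.range (algebraMap K L) :=
    mt (add_mem_cancel_right (H := (algebraMap K L).range) (RingHom.mem_range_self _ a)).1 hx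
  rw [hf.apply_of_notMem _ hx, hf.apply_of_notMem _ hxa] at h
  exact hx (mem_range_of_normDivSq_add_eq h5 ha h)

theorem card_le_two (hf : IsNormDivSqExtension G f) (h5 : Module.finrank K L = 5) {a b : L}
    (ha : a ≠ 0) {s : Finset L} (hs : ∀ x ∈ s, f (x + a) + f x = b)
    (hx : ∀ x ∈ s, x ∉ Set.range (algebraMap K L))
    (hxa : ∀ x ∈ s, x + a ∉ Set.range (algebraMap K L)) : s.card ≤ 2 := by
  classical
  rcases s.eq_empty_or_nonempty with rfl | ⟨x, hxs⟩
  · exact Nat.zero_le 2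
  have hsub : s ⊆ {x, x + a} := fun y hys => by
    have h := (hs x hxs).trans (hs y hys).symm
    rw [hf.apply_of_notMem _ (hx x hxs), hf.apply_of_notMem _ (hxa x hxs),
      hf.apply_of_notMem _ (hx y hys), hf.apply_of_notMem _ (hxa y hys)] at h
    rw [Finset.mem_insert, Finset.mem_singleton]
    exact eq_or_eq_add_of_normDivSq_add_eq h5 ha h
  exact (Finset.card_le_card hsub).trans Finset.card_le_two

theorem card_le_one (hf : IsNormDivSqExtension G f) (h5 : Module.finrank K L = 5) {a b : L}
    (ha : a ∉ Set.range (algebraMap K L)) {s : Finset L} (hs : ∀ x ∈ s, f (x + a) + f x = b)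
    (hx : ∀ x ∈ s, x ∈ Set.range (algebraMap K L)) : s.card ≤ 1 := by
  have : CharP L 2 := charP_of_injective_algebraMap (algebraMap K L).injective 2
  refine Finset.card_le_one.2 fun x hxs y hys => ?_
  have hxy := (hs x hxs).trans (hs y hys).symm
  obtain ⟨z, rfl⟩ := hx x hxs
  obtain ⟨w, rfl⟩ := hx y hys
  have hshift (z : K) : algebraMap K L z + a ∉ Set.range (algebraMap K L) :=
    mt (add_mem_cancel_left (H := (algebraMap K L).range) (RingHom.mem_range_self _ z)).1 ha
  rw [hf.apply_algebraMap, hf.apply_algebraMap, hf.apply_of_notMem _ (hshift z),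
    hf.apply_of_notMem _ (hshift w), add_comm, add_comm (normDivSq K _)] at hxy
  congr 1
  refine eq_of_normDivSq_add_mem_range h5 ha (c := G z + G w) ?_
  rw [map_add]
  grind

variable [Fintype L] [DecidableEq L]

theorem diffCount_le_two (hf : IsNormDivSqExtension G f) (h5 : Module.finrank K L = 5) {a : K}
    (ha : a ≠ 0) {b : L} (hb : b ∉ Set.range (algebraMap K L)) :
    diffCount f (algebraMap K L a) b ≤ 2 := by
  have hsol {x : L} (h : f (x + algebraMap K L a) + f x = b) : x ∉ Set.range (algebraMap K L) := by
    rintro ⟨z, rfl⟩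
    rw [← map_add, hf.apply_algebraMap, hf.apply_algebraMap, ← map_add] at h
    exact hb ⟨_, h⟩
  refine hf.card_le_two h5 ((_root_.map_ne_zero (algebraMap K L)).2 ha) (b := b)
    (fun x hx => (Finset.mem_filter.1 hx).2) (fun x hx => hsol (Finset.mem_filter.1 hx).2)
    fun x hx => ?_
  exact mt (add_mem_cancel_right (H := (algebraMap K L).range) (RingHom.mem_range_self _ a)).1
    (hsol (Finset.mem_filter.1 hx).2)

theorem diffCount_le_four (hf : IsNormDivSqExtension G f) (h5 : Module.finrank K L = 5) {a : L}
    (ha : a ∉ Set.range (algebraMap K L)) (b : L) : diffCount f a b ≤ 4 := by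
  classical
  have : CharP L 2 := charP_of_injective_algebraMap (algebraMap K L).injective 2
  set s := Finset.univ.filter fun x : L => f (x + a) + f x = b
  have hs {x : L} : x ∈ s ↔ f (x + a) + f x = b := Finset.mem_filter_univ x
  set t := s.filter (· ∈ Set.range (algebraMap K L)) with ht
  set u := s.filter fun x =>
    x ∉ Set.range (algebraMap K L) ∧ x + a ∉ Set.range (algebraMap K L) with hu
  have ht₁ : t.card ≤ 1 := hf.card_le_one h5 ha
    (fun x hx => hs.1 (Finset.mem_filter.1 hx).1) fun x hx => (Finset.mem_filter.1 hx).2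
  have ha0 : a ≠ 0 := fun h => ha ⟨0, by rw [h, map_zero]⟩
  have hu₂ : u.card ≤ 2 := hf.card_le_two h5 ha0
    (fun x hx => hs.1 (Finset.mem_filter.1 hx).1) (fun x hx => (Finset.mem_filter.1 hx).2.1)
    fun x hx => (Finset.mem_filter.1 hx).2.2
  have hcover : s ⊆ u ∪ t ∪ t.image (· + a) := fun x hx => by
    have hxa : x + a ∈ s := by rwa [hs, CharTwo.add_cancel_right, add_comm, ← hs]
    simp only [Finset.mem_union, Finset.mem_image, hu, ht, Finset.mem_filter]
    by_cases h : x + a ∈ Set.range (algebraMap K L)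
    · exact .inr ⟨x + a, ⟨hxa, h⟩, CharTwo.add_cancel_right x a⟩
    · tauto
  calc s.card ≤ (u ∪ t ∪ t.image (· + a)).card := Finset.card_le_card hcover
    _ ≤ u.card + t.card + (t.image (· + a)).card :=
      (Finset.card_union_le _ _).trans (by gcongr; exact Finset.card_union_le _ _)
    _ ≤ 2 + 1 + 1 := by gcongr; exact Finset.card_image_le.trans ht₁

end Perfect

variable [Fintype K] [DecidableEq K] [Fintype L] [DecidableEq L]

theorem diffCount_algebraMap (hf : IsNormDivSqExtension G f)
    (h5 : Module.finrank K L = 5) {a : K} (ha : a ≠ 0) (b : K) :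
    diffCount f (algebraMap K L a) (algebraMap K L b) = diffCount G a b := by
  have hsol (z : K) : f (algebraMap K L z + algebraMap K L a) + f (algebraMap K L z) =
      algebraMap K L b ↔ G (z + a) + G z = b := by
    rw [← map_add, hf.apply_algebraMap, hf.apply_algebraMap, ← map_add,
      (algebraMap K L).injective.eq_iff]
  symm
  refine Finset.card_bij (fun z _ => algebraMap K L z) (fun z hz => ?_)
    (fun _ _ _ _ h => (algebraMap K L).injective h) fun x hx => ?_
  · rwa [Finset.mem_filter_univ, hsol, ← Finset.mem_filter_univ (p := fun z => G (z + a) + G z = b)]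
  · rw [Finset.mem_filter_univ] at hx
    obtain ⟨z, rfl⟩ := hf.mem_range_of_add_eq h5 ha hx
    exact ⟨z, by rwa [Finset.mem_filter_univ, ← hsol], rfl⟩

theorem differentialUniformity_le_max (hf : IsNormDivSqExtension G f)
    (h5 : Module.finrank K L = 5) :
    differentialUniformity f ≤ max 4 (differentialUniformity G) := by
  refine differentialUniformity_le fun a b ha => ?_
  by_cases haK : a ∈ Set.range (algebraMap K L)
  · obtain ⟨a, rfl⟩ := haK
    rw [_root_.map_ne_zero] at ha
    by_cases hbK : b ∈ Set.range (algebraMap K L)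
    · obtain ⟨b, rfl⟩ := hbK
      rw [hf.diffCount_algebraMap h5 ha]
      exact le_max_of_le_right (diffCount_le_differentialUniformity G ha b)
    · exact le_max_of_le_left ((hf.diffCount_le_two h5 ha hbK).trans (by norm_num))
  · exact le_max_of_le_left (hf.diffCount_le_four h5 haK b)

theorem le_differentialUniformity (hf : IsNormDivSqExtension G f)
    (h5 : Module.finrank K L = 5) : differentialUniformity G ≤ differentialUniformity f := by
  refine differentialUniformity_le fun a b ha => ?_
  rw [← hf.diffCount_algebraMap h5 ha]
  exact diffCount_le_differentialUniformity f ((_root_.map_ne_zero _).2 ha) _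

end IsNormDivSqExtension
end Extension

section Finite

theorem pow_injective_of_coprime {G : Type*} [GroupWithZero G] {n : ℕ} (hn : n ≠ 0)
    (h : (Nat.card Gˣ).Coprime n) : Function.Injective fun x : G => x ^ n := by
  intro x y hxy
  simp only at hxy
  rcases eq_or_ne x 0 with rfl | hx
  · rw [zero_pow hn, eq_comm, pow_eq_zero_iff hn] at hxy
    exact hxy.symm
  have hy : y ≠ 0 := by
    rwa [← pow_ne_zero_iff hn, ← hxy, pow_ne_zero_iff hn]
  have := (powCoprime h).injective (a₁ := Units.mk0 x hx) (a₂ := Units.mk0 y hy)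
    (Units.ext hxy)
  exact congrArg Units.val this

theorem pow_two_pow_sub_one_injective {K : Type*} [Field K] [Fintype K] {k m : ℕ}
    (hK : Fintype.card K = 2 ^ k) (hm : m ≠ 0) (hkm : k.Coprime m) :
    Function.Injective fun x : K => x ^ (2 ^ m - 1) := by
  refine pow_injective_of_coprime (Nat.sub_ne_zero_of_lt (Nat.one_lt_two_pow hm)) ?_
  rw [Nat.card_units, Nat.card_eq_fintype_card, hK, Nat.Coprime,
    Nat.pow_sub_one_gcd_pow_sub_one, hkm, pow_one]

variable {K F : Type*} [Field K] [Fintype K] [Field F] [Algebra K F]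

theorem mem_range_algebraMap_of_pow_card_eq [Finite F] {x : F} (hx : x ^ Fintype.card K = x) :
    x ∈ Set.range (algebraMap K F) := by
  refine (IsGalois.mem_range_algebraMap_iff_fixed x).2 fun σ => ?_
  obtain ⟨n, rfl⟩ := (FiniteField.bijective_frobeniusAlgEquivOfAlgebraic_pow K F).2 σ
  rw [AlgEquiv.coe_pow, FiniteField.coe_frobeniusAlgEquivOfAlgebraic]
  exact Function.iterate_fixed hx n

theorem finrank_eq_of_card_eq_pow {q n : ℕ} [Fintype F] (hK : Fintype.card K = q)
    (hF : Fintype.card F = q ^ n) : Module.finrank K F = n := by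
  subst hK
  exact Nat.pow_right_injective Fintype.one_lt_card
    (Module.card_eq_pow_finrank.symm.trans hF)

theorem dobbertinExp_add_two (k : ℕ) :
    dobbertinExp k + 2 = ∑ i ∈ Finset.range 5, (2 ^ k) ^ i := by
  have : 1 ≤ 2 ^ (4 * k) + 2 ^ (3 * k) + 2 ^ (2 * k) + 2 ^ k :=
    le_add_left Nat.one_le_two_pow
  simp only [Finset.sum_range_succ, Finset.sum_range_zero, dobbertinExp, ← pow_mul, mul_comm k,
    zero_mul, one_mul, pow_zero]
  omega

theorem dobbertinExp_ne_zero (k : ℕ) : dobbertinExp k ≠ 0 :=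
  Nat.sub_ne_zero_of_lt (Nat.one_le_two_pow.trans_lt (Nat.lt_add_of_pos_left (by positivity)))

theorem pow_dobbertinExp_eq_normDivSq [Finite F] {k : ℕ} (hK : Fintype.card K = 2 ^ k)
    (h5 : Module.finrank K F = 5) (x : F) : x ^ dobbertinExp k = normDivSq K x := by
  rcases eq_or_ne x 0 with rfl | hx
  · rw [zero_pow (dobbertinExp_ne_zero k), normDivSq_zero]
  · rw [normDivSq, eq_div_iff (pow_ne_zero 2 hx), ← pow_add, dobbertinExp_add_two,
      FiniteField.algebraMap_norm_eq_pow_sum, h5, Nat.card_eq_fintype_card, hK]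

theorem modifiedDobbertin_algebraMap [CharP K 2] {k : ℕ} (hk : k ≠ 0)
    (hK : Fintype.card K = 2 ^ k) (g : K[X]) (z : K) :
    modifiedDobbertin k g (algebraMap K F z) = algebraMap K F (g.eval z) := by
  have h0 : algebraMap K F z + algebraMap K F z ^ 2 ^ k = 0 := by
    rw [← map_pow, ← hK, FiniteField.pow_card, ← map_add, CharTwo.add_self_eq_zero, map_zero]
  have he : 2 ^ (5 * k) - 1 ≠ 0 := Nat.sub_ne_zero_of_lt (Nat.one_lt_two_pow (by omega))
  rw [modifiedDobbertin, h0, zero_pow he, mul_zero, add_zero,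
    aeval_algebraMap_apply_eq_algebraMap_eval]

theorem modifiedDobbertin_of_notMem [CharP K 2] [Fintype F] {k : ℕ} (hK : Fintype.card K = 2 ^ k)
    (hF : Fintype.card F = 2 ^ (5 * k)) (g : K[X]) {x : F}
    (hx : x ∉ Set.range (algebraMap K F)) : modifiedDobbertin k g x = x ^ dobbertinExp k := by
  have : CharP F 2 := charP_of_injective_algebraMap (algebraMap K F).injective 2
  have h0 : x + x ^ 2 ^ k ≠ 0 := fun h =>
    hx (mem_range_algebraMap_of_pow_card_eq (by rw [hK, ← CharTwo.add_eq_zero.1 h]))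
  rw [modifiedDobbertin, ← hF, FiniteField.pow_card_sub_one_eq_one _ h0, mul_one,
    CharTwo.add_cancel_left]

theorem isNormDivSqExtension_modifiedDobbertin [CharP K 2] [Fintype F] {k : ℕ}
    (hK : Fintype.card K = 2 ^ k) (hF : Fintype.card F = 2 ^ (5 * k)) (g : K[X]) :
    IsNormDivSqExtension (fun z => g.eval z) (modifiedDobbertin k g : F → F) where
  apply_algebraMap :=
    modifiedDobbertin_algebraMap (by rintro rfl; exact Fintype.one_lt_card.ne' hK) hK g
  apply_of_notMem x hx := by
    rw [modifiedDobbertin_of_notMem hK hF g hx, pow_dobbertinExp_eq_normDivSq hK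
      (finrank_eq_of_card_eq_pow hK (by rw [hF, mul_comm, pow_mul]))]

end Finite

theorem mainTheorem2_general {K F : Type*} [Field K] [Fintype K] [DecidableEq K]
    [Field F] [Fintype F] [DecidableEq F] [Algebra K F] [Algebra (ZMod 2) K]
    (k : ℕ) (hK : Fintype.card K = 2 ^ k) (hF : Fintype.card F = 2 ^ (5 * k)) (p : K → K)
    (L₁ L₂ : K ≃ᵃ[ZMod 2] K) (g : Polynomial K) (hg : ∀ x : K, g.eval x = L₁ (p (L₂ x))) :
    (Odd k → Function.Injective p → Function.Bijective (modifiedDobbertin k g : F → F)) ∧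
      differentialUniformity p ≤ differentialUniformity (modifiedDobbertin k g : F → F) ∧
      differentialUniformity (modifiedDobbertin k g : F → F) ≤
        max 4 (differentialUniformity p) := by
  have : CharP K 2 := charP_of_injective_algebraMap (algebraMap (ZMod 2) K).injective 2
  have h5 : Module.finrank K F = 5 :=
    finrank_eq_of_card_eq_pow hK (by rw [hF, mul_comm, pow_mul])
  have hf := isNormDivSqExtension_modifiedDobbertin (F := F) hK hF g
  simp only [hg] at hf
  rw [← differentialUniformity_affineEquiv_comp p L₁ L₂]
  refine ⟨fun hk hp => ?_, hf.le_differentialUniformity h5, hf.differentialUniformity_le_max h5⟩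
  have hcube : Function.Injective fun c : K => c ^ 3 :=
    pow_two_pow_sub_one_injective hK two_ne_zero (Nat.coprime_two_right.2 hk)
  exact Finite.injective_iff_bijective.1 <| hf.injective h5
    (Finite.injective_iff_bijective.1 hcube) (L₁.injective.comp (hp.comp L₂.injective))

theorem mainTheorem2 {K F : Type*} [Field K] [Fintype K] [DecidableEq K]
    [Field F] [Fintype F] [DecidableEq F] [Algebra K F] [Algebra (ZMod 2) K]
    (k m : ℕ) (hk : Odd k) (hm : 1 ≤ m) (hkm : Nat.gcd k m = 1)
    (hK : Fintype.card K = 2 ^ k) (hF : Fintype.card F = 2 ^ (5 * k))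
    (L₁ L₂ : K ≃ᵃ[ZMod 2] K)
    (g : Polynomial K) (hg : ∀ x : K, g.eval x = L₁ ((L₂ x) ^ (2 ^ m - 1))) :
    (differentialUniformity (fun x : K => x ^ (2 ^ m - 1)) = 2 →
      Function.Bijective (modifiedDobbertin k g : F → F) ∧
        differentialUniformity (modifiedDobbertin k g : F → F) ≤ 4) ∧
    (differentialUniformity (fun x : K => x ^ (2 ^ m - 1)) = 4 →
      Function.Bijective (modifiedDobbertin k g : F → F) ∧
        differentialUniformity (modifiedDobbertin k g : F → F) = 4) ∧
    (differentialUniformity (fun x : K => x ^ (2 ^ m - 1)) = 6 →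
      Function.Bijective (modifiedDobbertin k g : F → F) ∧
        differentialUniformity (modifiedDobbertin k g : F → F) = 6) := by
  obtain ⟨hbij, hge, hle⟩ :=
    mainTheorem2_general (F := F) k hK hF (fun x => x ^ (2 ^ m - 1)) L₁ L₂ g hg
  have hbij := hbij hk (pow_two_pow_sub_one_injective hK (Nat.ne_of_gt hm) hkm)
  refine ⟨fun h => ⟨hbij, ?_⟩, fun h => ⟨hbij, ?_⟩, fun h => ⟨hbij, ?_⟩⟩ <;> omega
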